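/- Let $M\in\mathbb N$ and let $\Sigma_M=\{0,1,\dots,M\}^{\mathbb N}$ (one-sided sequences $x=x_1x_2\dots$) carry the product topology, the shift $\sigma$, the reflection $\overline{x}=(M-x_i)_{i\ge 1}$ and the lexicographic order $\preccurlyeq$. For a word $w=w_1\dots w_n$ write $\overline{w}=(M-w_1)\dots(M-w_n)$, $w^{+}=w_1\dots w_{n-1}(w_n+1)$ (if $w_n<M$), $w^{-}=w_1\dots w_{n-1}(w_n-1)$ (if $w_n>0$), and $w^\infty=www\dots$. For $q\in(1,M+1]$ let $\alpha(q)$ be the quasi-greedy expansion of $1$ in base $q$, i.e. the lexicographically largest sequence $x\in\Sigma_M$ with infinitely many non-zero digits and $\sum_{i\ge1}x_iq^{-i}=1$. Put $$\mathbf V=\{a\in\Sigma_M:\overline a\preccurlyeq\sigma^n(a)\preccurlyeq a\ \text{ for all } n\ge0\},\qquad \mathcal V=\{q\in(1,M+1]:\alpha(q)\in\mathbf V\},$$ $$\mathbf V_q=\{x\in\Sigma_M:\overline{\alpha(q)}\preccurlyeq\sigma^n(x)\preccurlyeq\alpha(q)\ \text{ for all } n\ge0\}.$$ A sequence $a\in\mathbf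 V$ is *irreducible* if $a_1\dots a_j\,(\overline{a_1\dots a_j}^{\,+})^\infty\prec a$ for every $j\ge1$ such that $a_j>0$ and $(a_1\dots a_j^-)^\infty\in\mathbf V$; let $I=\{q\in\mathcal V:\alpha(q)\text{ is irreducible}\}$. *Natural approximation from below.* For $q\in\mathcal V$ let $n_1<n_2<\cdots$ be the integers $n\ge1$ with $\alpha_n(q)>0$ and $(\alpha_1(q)\dots\alpha_n(q)^-)^\infty\in\mathbf V$, and let $q^-_m\in\mathcal V$ be the base with $\alpha(q^-_m)=(\alpha_1(q)\dots\alpha_{n_m}(q)^-)^\infty$. If there are only finitely many such integers, say $N\ge 0$ of them, put $q^-_m=q$ for all $m>N$. *Subshifts.* A subshift is a non-empty closed set $X\subset\Sigma_M$ with $\sigma(X)\subset X$. Its language $\mathcal L(X)$ is the set of finite words (including the empty one) occurring in elements of $X$. It is of finite type if it is the set of all sequences that avoid some finite set of words, and transitive if for all $u,v\in\mathcal L(X)$ there is $w\in\mathcal L(X)$ with $uwv\in\mathcal L(X)$. It is a *coded system* if $X=\overline{\bigcup_{n\ge1}X_n}$ for some transitive subshifts of finite type $X_1\subset X_2\subset\cdots$.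 **Proposition.** Let $q\in I$. Then $(\mathbf V_q,\sigma)$ is a coded system. Moreover, $q^-_m\in I$ for infinitely many $m$, and for every strictly increasing sequence of indices $m_1<m_2<\cdots$ with $q^-_{m_j}\in I$ for all $j$, each $(\mathbf V_{q^-_{m_j}},\sigma)$ is a transitive subshift of finite type, $\mathbf V_{q^-_{m_j}}\subset\mathbf V_{q^-_{m_{j+1}}}$ for all $j$, and $$\mathbf V_q=\overline{\bigcup_{j\ge1}\mathbf V_{q^-_{m_j}}}.$$ -/

import Mathlib

namespace SymShift

/-- One-sided sequences over the alphabet `{0, …, M}`, with the product topology. The digit `x_{i+1}`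
of the usual notation `x = x_1 x_2 …` is `x i`. -/
abbrev Seq (M : ℕ) : Type := ℕ → Fin (M + 1)

/-- Finite words over the alphabet `{0, …, M}`. -/
abbrev Word (M : ℕ) : Type := List (Fin (M + 1))

/-- The one-sided shift `σ`. -/
def shift {M : ℕ} (x : Seq M) : Seq M := fun i => x (i + 1)

/-- The reflection `(M - x_i)` of a sequence (`Fin.rev d = M - d` on `Fin (M + 1)`). -/
def reflect {M : ℕ} (x : Seq M) : Seq M := fun i => Fin.rev (x i)

/-- The strict lexicographic order on sequences. -/
def LexLT {M : ℕ} (x y : Seq M) : Prop := ∃ n, (∀ i < n, x i = y i) ∧ x n < y n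

/-- The lexicographic order on sequences. -/
def LexLE {M : ℕ} (x y : Seq M) : Prop := x = y ∨ LexLT x y

/-! ### Subshifts -/

/-- The word `w` occurs somewhere in the sequence `x`. -/
def IsFactor {M : ℕ} (w : Word M) (x : Seq M) : Prop :=
  ∃ k : ℕ, ∀ (i : ℕ) (hi : i < w.length), w[i] = x (k + i)

/-- The language of `X`: all words (including the empty one) occurring in elements of `X`. -/
def language {M : ℕ} (X : Set (Seq M)) : Set (Word M) := {w | ∃ x ∈ X, IsFactor w x}

/-- A subshift: a non-empty, closed, forward-shift-invariant set of sequences. -/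
def IsSubshift {M : ℕ} (X : Set (Seq M)) : Prop :=
  X.Nonempty ∧ IsClosed X ∧ ∀ x ∈ X, shift x ∈ X

/-- A subshift of finite type: a subshift given by finitely many forbidden words. -/
def IsSFT {M : ℕ} (X : Set (Seq M)) : Prop :=
  IsSubshift X ∧ ∃ F : Set (Word M), F.Finite ∧ X = {x | ∀ w ∈ F, ¬ IsFactor w x}

/-- Topological transitivity: any two words of the language can be connected, in this order, by
a (possibly empty) word. -/
def IsTransitive {M : ℕ} (X : Set (Seq M)) : Prop :=
  ∀ u ∈ language X, ∀ v ∈ language X, ∃ w ∈ language X, u ++ w ++ v ∈ language X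

/-- A coded system: a subshift that is the closure of an increasing union of transitive
subshifts of finite type. -/
def IsCoded {M : ℕ} (X : Set (Seq M)) : Prop :=
  IsSubshift X ∧ ∃ Y : ℕ → Set (Seq M),
    (∀ n, IsSFT (Y n) ∧ IsTransitive (Y n)) ∧ (∀ n, Y n ⊆ Y (n + 1)) ∧ X = closure (⋃ n, Y n)

/-! ### Expansions in non-integer bases -/

/-- `x` is an expansion of `1` in base `q`: `∑_{i ≥ 1} x_i / q ^ i = 1`. -/
def IsExpansionOne {M : ℕ} (q : ℝ) (x : Seq M) : Prop :=
  HasSum (fun i : ℕ => ((x i : ℕ) : ℝ) / q ^ (i + 1)) 1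

/-- `x` is an infinite expansion of `1` in base `q`: it has infinitely many non-zero digits. -/
def IsInfiniteExpansionOne {M : ℕ} (q : ℝ) (x : Seq M) : Prop :=
  IsExpansionOne q x ∧ {i | x i ≠ 0}.Infinite

/-- `a` is the quasi-greedy expansion of `1` in base `q`: the lexicographically largest infinite
expansion of `1` in base `q`. -/
def IsQuasiGreedy {M : ℕ} (q : ℝ) (a : Seq M) : Prop :=
  IsInfiniteExpansionOne q a ∧ ∀ b : Seq M, IsInfiniteExpansionOne q b → LexLE b a

open Classical in
/-- The quasi-greedy expansion `α(q)` of `1` in base `q`, for `1 < q ≤ M + 1` (a junk value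
elsewhere). -/
noncomputable def quasiGreedy (M : ℕ) (q : ℝ) : Seq M :=
  if h : ∃ a : Seq M, IsQuasiGreedy q a then h.choose else fun _ => 0

/-- The set of sequences `a` with `reflect a ≼ σⁿ(a) ≼ a` for all `n ≥ 0`. -/
def seqV (M : ℕ) : Set (Seq M) :=
  {a | ∀ n : ℕ, LexLE (reflect a) (shift^[n] a) ∧ LexLE (shift^[n] a) a}

/-- The set of bases `q ∈ (1, M + 1]` whose quasi-greedy expansion of `1` lies in `seqV M`. -/
def baseV (M : ℕ) : Set ℝ := {q | 1 < q ∧ q ≤ (M : ℝ) + 1 ∧ quasiGreedy M q ∈ seqV M}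

/-- The symmetric `q`-shift: all `x` with `reflect α(q) ≼ σⁿ(x) ≼ α(q)` for all `n ≥ 0`. -/
def symShift (M : ℕ) (q : ℝ) : Set (Seq M) :=
  {x | ∀ n : ℕ, LexLE (reflect (quasiGreedy M q)) (shift^[n] x) ∧
    LexLE (shift^[n] x) (quasiGreedy M q)}

/-! ### Irreducible sequences -/

/-- The periodic sequence `(a_1 … a_n⁻)^∞`, where `a_1 … a_n⁻ = a_1 … a_{n-1} (a_n - 1)`. It is
used only if `n ≥ 1` and `a_n > 0`. -/
def lowerPeriodic {M : ℕ} (a : Seq M) (n : ℕ) : Seq M :=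
  fun i => if i % n = n - 1 then a (n - 1) - 1 else a (i % n)

/-- The sequence `a_1 … a_n (b_1 … b_n⁺)^∞`, where `b_i = M - a_i` and
`b_1 … b_n⁺ = b_1 … b_{n-1} (b_n + 1)`. It is used only if `n ≥ 1` and `a_n > 0`. -/
def upperTail {M : ℕ} (a : Seq M) (n : ℕ) : Seq M :=
  fun i => if i < n then a i
    else if i % n = n - 1 then Fin.rev (a (n - 1)) + 1 else Fin.rev (a (i % n))

/-- The word `a_1 … a_n⁻` makes sense and `(a_1 … a_n⁻)^∞` belongs to `seqV M`. -/
def IsCut {M : ℕ} (a : Seq M) (n : ℕ) : Prop :=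
  0 < n ∧ 0 < a (n - 1) ∧ lowerPeriodic a n ∈ seqV M

/-- Irreducible sequences. -/
def IsIrreducibleSeq {M : ℕ} (a : Seq M) : Prop :=
  a ∈ seqV M ∧ ∀ j : ℕ, IsCut a j → LexLT (upperTail a j) a

/-- The set `I` of bases `q ∈ baseV M` with irreducible quasi-greedy expansion `α(q)`. -/
def irreducibleBases (M : ℕ) : Set ℝ := {q | q ∈ baseV M ∧ IsIrreducibleSeq (quasiGreedy M q)}

/-! ### The natural approximation from below -/

open Classical in
/-- The natural approximation of `q ∈ baseV M` from below; `naturalApprox M q m` is the term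
`q⁻_{m+1}`. With `n_1 < n_2 < …` the cuts of `α(q)`, the term `q⁻_m` is the base in `baseV M` whose
quasi-greedy expansion is `(α_1 … α_{n_m}⁻)^∞`. If there are only finitely many cuts, say `N`
(possibly `N = 0`), then all terms from `q⁻_{N+1}` on are equal to `q`.
(`Nat.nth p m` is the natural number with index `m`, counted from `0`, satisfying `p`; it is `0`,
which is never a cut, if there is no such number.) -/
noncomputable def naturalApprox (M : ℕ) (q : ℝ) (m : ℕ) : ℝ :=
  let n := Nat.nth (IsCut (quasiGreedy M q)) m
  if IsCut (quasiGreedy M q) n then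
    Function.invFunOn (quasiGreedy M) (baseV M) (lowerPeriodic (quasiGreedy M q) n)
  else q

end SymShift

/-! Write `a` for α(q), a' for its reflection, and U_n for `upperTail a n`, that is, a_1…a_n
followed by the reflection of (a_1…a_n⁻)^∞. The core is combinatorics of words in `shiftSet a`.
Expansions enter only through `exists_quasiGreedy_eq`: every element of `seqV M` is some α(q') when
M > 0, so the bases q⁻_m exist and have the prescribed expansions.

Cuts are governed by overlaps: away from the golden sequence, n ≥ 2 is a cut iff no proper suffix of
a_1…a_n is a prefix of a'. If there were no cuts beyond some point, one overlap would persist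
forever and give σ^l(a) = a'. The least such l is a cut with a ≺ U_l, contrary to irreducibility;
hence there are infinitely many cuts (`exists_isCut_gt`). A reducible approximation (a_1…a_n⁻)^∞
lies below some U_j, j < n, whose own approximation (a_1…a_j⁻)^∞ is irreducible
(`exists_isIrreducibleSeq_le_upperTail`). Were there finitely many irreducible approximations,
finitely many U_j ≺ a would bound a sequence converging to a, which is impossible.

For transitivity, a finite word restricts its continuations only through suffixes that are prefixes
of a or a'. After a_1…a_n at a cut n, following U_n ≺ a long enough leaves only such suffixes
shorter than n, whose lengths are again cuts (up to length 1), and induction on n applies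
(`reaches_of_isCut`). Periodicity of the approximations gives finite type. Density holds because a
tail starting with a long prefix of a or a' can be exchanged for an approximation or its reflection.
The golden sequence has no cuts and is treated directly: its shift space consists of sequences of
period two. -/

namespace SymShift

variable {M : ℕ}

/-! ### Lexicographic order -/

/-- `x` is lexicographically smaller than `y`, the difference being visible before index `n`. -/
def LTBefore (n : ℕ) (x y : Seq M) : Prop := ∃ t < n, (∀ i < t, x i = y i) ∧ x t < y t

/-- The sequences `x` and `y` have the same first `n` digits. -/
def Agree (n : ℕ) (x y : Seq M) : Prop := ∀ i < n, x i = y i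

theorem lexLE_iff_toLex {x y : Seq M} : LexLE x y ↔ toLex x ≤ toLex y := by
  rw [le_iff_eq_or_lt, LexLE, toLex_inj]
  exact Iff.rfl

theorem LexLE.refl (x : Seq M) : LexLE x x := Or.inl rfl

theorem LexLE.trans {x y z : Seq M} (h : LexLE x y) (h' : LexLE y z) : LexLE x z := by
  rw [lexLE_iff_toLex] at *; exact h.trans h'

theorem LexLE.antisymm {x y : Seq M} (h : LexLE x y) (h' : LexLE y x) : x = y := by
  rw [lexLE_iff_toLex] at *; exact toLex_inj.1 (h.antisymm h')

theorem not_lexLE {x y : Seq M} : ¬ LexLE x y ↔ LexLT y x := by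
  rw [lexLE_iff_toLex, not_le]
  exact Iff.rfl

theorem not_lexLT {x y : Seq M} : ¬ LexLT x y ↔ LexLE y x := by
  rw [← not_lexLE, not_not]

theorem LexLT.le {x y : Seq M} (h : LexLT x y) : LexLE x y := Or.inr h

theorem LexLT.exists_ltBefore {x y : Seq M} (h : LexLT x y) : ∃ n, LTBefore n x y := by
  obtain ⟨n, h⟩ := h
  exact ⟨n + 1, n, by omega, h⟩

theorem LTBefore.lt {n : ℕ} {x y : Seq M} (h : LTBefore n x y) : LexLT x y := by
  obtain ⟨t, -, h⟩ := h
  exact ⟨t, h⟩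

theorem LTBefore.le {n : ℕ} {x y : Seq M} (h : LTBefore n x y) : LexLE x y := h.lt.le

theorem LTBefore.not_ge {n : ℕ} {x y : Seq M} (h : LTBefore n x y) : ¬ LexLE y x :=
  not_lexLE.2 h.lt

theorem LTBefore.mono {m n : ℕ} {x y : Seq M} (h : LTBefore m x y) (hmn : m ≤ n) :
    LTBefore n x y := by
  obtain ⟨t, ht, h⟩ := h
  exact ⟨t, by omega, h⟩

theorem Agree.symm {n : ℕ} {x y : Seq M} (h : Agree n x y) : Agree n y x :=
  fun i hi => (h i hi).symm

theorem Agree.trans {n : ℕ} {x y z : Seq M} (h : Agree n x y) (h' : Agree n y z) : Agree n x z :=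
  fun i hi => (h i hi).trans (h' i hi)

theorem Agree.mono {m n : ℕ} {x y : Seq M} (h : Agree n x y) (hmn : m ≤ n) : Agree m x y :=
  fun i hi => h i (by omega)

theorem LTBefore.congr {n : ℕ} {x y x' y' : Seq M} (h : LTBefore n x y) (hx : Agree n x x')
    (hy : Agree n y y') : LTBefore n x' y' := by
  obtain ⟨t, ht, h1, h2⟩ := h
  refine ⟨t, ht, fun i hi => ?_, ?_⟩
  · rw [← hx i (by omega), ← hy i (by omega), h1 i hi]
  · rwa [← hx t ht, ← hy t ht]

theorem LTBefore.not_agree {n : ℕ} {x y : Seq M} (h : LTBefore n x y) : ¬ Agree n x y := by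
  obtain ⟨t, ht, -, h⟩ := h
  intro h'
  rw [h' t ht] at h
  exact lt_irrefl _ h

theorem LexLT.agree_or_ltBefore {x y : Seq M} (h : LexLT x y) (n : ℕ) :
    Agree n x y ∨ LTBefore n x y := by
  obtain ⟨t, h1, h2⟩ := h
  rcases lt_or_ge t n with ht | ht
  · exact Or.inr ⟨t, ht, h1, h2⟩
  · exact Or.inl fun i hi => h1 i (by omega)

theorem LexLE.agree_or_ltBefore {x y : Seq M} (h : LexLE x y) (n : ℕ) :
    Agree n x y ∨ LTBefore n x y := by
  rcases h with rfl | h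
  · exact Or.inl fun i _ => rfl
  · exact h.agree_or_ltBefore n

theorem LTBefore.trans_le {n : ℕ} {x y z : Seq M} (h : LTBefore n x y) (h' : LexLE y z) :
    LTBefore n x z := by
  rcases h'.agree_or_ltBefore n with h' | ⟨s, hs, h1', h2'⟩
  · exact h.congr (fun _ _ => rfl) h'
  · obtain ⟨t, ht, h1, h2⟩ := h
    rcases lt_trichotomy s t with hst | rfl | hst
    · exact ⟨s, hs, fun i hi => (h1 i (by omega)).trans (h1' i hi), by rwa [h1 s hst]⟩
    · exact ⟨s, hs, fun i hi => (h1 i hi).trans (h1' i hi), h2.trans h2'⟩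
    · exact ⟨t, ht, fun i hi => (h1 i hi).trans (h1' i (by omega)), by rwa [← h1' t hst]⟩

theorem LexLE.trans_ltBefore {n : ℕ} {x y z : Seq M} (h' : LexLE x y) (h : LTBefore n y z) :
    LTBefore n x z := by
  rcases h'.agree_or_ltBefore n with h' | ⟨s, hs, h1', h2'⟩
  · exact h.congr h'.symm (fun _ _ => rfl)
  · obtain ⟨t, ht, h1, h2⟩ := h
    rcases lt_trichotomy s t with hst | rfl | hst
    · exact ⟨s, hs, fun i hi => (h1' i hi).trans (h1 i (by omega)), by rwa [← h1 s hst]⟩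
    · exact ⟨s, hs, fun i hi => (h1' i hi).trans (h1 i hi), h2'.trans h2⟩
    · exact ⟨t, ht, fun i hi => (h1' i (by omega)).trans (h1 i hi), by rwa [h1' t hst]⟩

/-! ### Shift and reflection -/

theorem shift_iterate_apply (n : ℕ) (x : Seq M) (i : ℕ) : shift^[n] x i = x (n + i) := by
  induction n generalizing x with
  | zero => simp
  | succ n ih => rw [Function.iterate_succ_apply, ih, shift]; congr 1; omega

theorem shift_iterate_shift_iterate (m n : ℕ) (x : Seq M) :
    shift^[m] (shift^[n] x) = shift^[n + m] x := by
  rw [add_comm, Function.iterate_add_apply]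

theorem reflect_reflect (x : Seq M) : reflect (reflect x) = x := by
  funext i; simp [reflect]

theorem reflect_apply_val (x : Seq M) (i : ℕ) : (reflect x i).val = M - (x i).val := by
  simp [reflect, Fin.val_rev]

theorem shift_iterate_reflect (n : ℕ) (x : Seq M) :
    shift^[n] (reflect x) = reflect (shift^[n] x) := by
  funext i; simp [shift_iterate_apply, reflect]

theorem Agree.reflect {n : ℕ} {x y : Seq M} (h : Agree n x y) : Agree n (reflect x) (reflect y) :=
  fun i hi => by simp [SymShift.reflect, h i hi]

theorem LTBefore.reflect {n : ℕ} {x y : Seq M} (h : LTBefore n x y) :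
    LTBefore n (reflect y) (reflect x) := by
  obtain ⟨t, ht, h1, h2⟩ := h
  exact ⟨t, ht, fun i hi => by simp [SymShift.reflect, h1 i hi], Fin.rev_lt_rev.2 h2⟩

theorem LexLE.reflect {x y : Seq M} (h : LexLE x y) : LexLE (reflect y) (reflect x) := by
  rcases h with rfl | h
  · exact LexLE.refl _
  · obtain ⟨n, hn⟩ := h.exists_ltBefore
    exact hn.reflect.le

theorem Agree.shift_le {n : ℕ} {x y : Seq M} (h : Agree n x y) (h' : LexLE x y) :
    LexLE (shift^[n] x) (shift^[n] y) := by
  rcases h' with rfl | ⟨t, h1, h2⟩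
  · exact LexLE.refl _
  · have ht : n ≤ t := by
      by_contra hlt
      rw [h t (by omega)] at h2
      exact lt_irrefl _ h2
    refine Or.inr ⟨t - n, fun i hi => ?_, ?_⟩
    · rw [shift_iterate_apply, shift_iterate_apply, h1 _ (by omega)]
    · rw [shift_iterate_apply, shift_iterate_apply, show n + (t - n) = t by omega]
      exact h2

theorem Agree.ext_of_shift {n : ℕ} {x y : Seq M} (h : Agree n x y)
    (h' : shift^[n] x = shift^[n] y) : x = y := by
  funext i
  rcases lt_or_ge i n with hi | hi
  · exact h i hi
  · have := congrFun h' (i - n)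
    rwa [shift_iterate_apply, shift_iterate_apply, show n + (i - n) = i by omega] at this

theorem LexLE.apply_zero_le {x y : Seq M} (h : LexLE x y) : x 0 ≤ y 0 := by
  rcases h.agree_or_ltBefore 1 with h | ⟨t, ht, -, h⟩
  · exact (h 0 (by omega)).le
  · obtain rfl : t = 0 := by omega
    exact h.le

theorem shift_iterate_eq_of_mul {n : ℕ} {x : Seq M} (h : shift^[n] x = x) (k : ℕ) :
    shift^[n * k] x = x := by
  rw [Function.iterate_mul]
  exact Function.iterate_fixed h k

theorem apply_add_mul {n : ℕ} {x : Seq M} (h : shift^[n] x = x) (k i : ℕ) :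
    x (n * k + i) = x i := by
  rw [← shift_iterate_apply (n * k) x i, shift_iterate_eq_of_mul h]

theorem apply_mod {n : ℕ} {x : Seq M} (h : shift^[n] x = x) (i : ℕ) : x (i % n) = x i := by
  conv_rhs => rw [← Nat.div_add_mod i n]
  rw [apply_add_mul h]

/-- Two sequences with a common period that agree on one period are equal. -/
theorem Agree.ext_of_periodic {n : ℕ} (hn : 0 < n) {x y : Seq M} (h : Agree n x y)
    (hx : shift^[n] x = x) (hy : shift^[n] y = y) : x = y := by
  funext i
  rw [← apply_mod hx, ← apply_mod hy]
  exact h _ (Nat.mod_lt _ hn)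

/-! ### The shift spaces bounded by a sequence and its reflection -/

/-- All sequences whose shifts are bounded by `reflect a` and `a`. -/
def shiftSet (a : Seq M) : Set (Seq M) :=
  {x | ∀ n : ℕ, LexLE (reflect a) (shift^[n] x) ∧ LexLE (shift^[n] x) a}

theorem symShift_eq_shiftSet (q : ℝ) : symShift M q = shiftSet (quasiGreedy M q) := rfl

theorem mem_seqV_iff {a : Seq M} : a ∈ seqV M ↔ a ∈ shiftSet a := Iff.rfl

theorem shift_iterate_mem {a x : Seq M} (h : x ∈ shiftSet a) (n : ℕ) : shift^[n] x ∈ shiftSet a := by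
  intro m
  rw [shift_iterate_shift_iterate]
  exact h _

theorem reflect_mem {a x : Seq M} (h : x ∈ shiftSet a) : reflect x ∈ shiftSet a := by
  intro n
  rw [shift_iterate_reflect]
  refine ⟨(h n).2.reflect, ?_⟩
  have := (h n).1.reflect
  rwa [reflect_reflect] at this

theorem shiftSet_mono {a b : Seq M} (h : LexLE b a) : shiftSet b ⊆ shiftSet a :=
  fun _ hx n => ⟨h.reflect.trans (hx n).1, (hx n).2.trans h⟩

theorem apply_le_of_mem {a x : Seq M} (h : x ∈ shiftSet a) (i : ℕ) : (x i).val ≤ (a 0).val := by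
  have := (h i).2.apply_zero_le
  rwa [shift_iterate_apply, add_zero] at this

theorem le_apply_of_mem {a x : Seq M} (h : x ∈ shiftSet a) (i : ℕ) : M - (a 0).val ≤ (x i).val := by
  have := (h i).1.apply_zero_le
  rw [shift_iterate_apply, add_zero, Fin.le_def, reflect_apply_val] at this
  exact this

/-! ### Concatenation -/

/-- The first `k` digits of `x` followed by `y`. -/
def cat (x : Seq M) (k : ℕ) (y : Seq M) : Seq M := fun i => if i < k then x i else y (i - k)

theorem agree_cat (x : Seq M) (k : ℕ) (y : Seq M) : Agree k (cat x k y) x :=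
  fun i hi => by simp [cat, hi]

theorem cat_apply_add (x : Seq M) (k : ℕ) (y : Seq M) (i : ℕ) : cat x k y (k + i) = y i := by
  simp [cat]

theorem shift_cat (x : Seq M) (k : ℕ) (y : Seq M) : shift^[k] (cat x k y) = y := by
  funext i
  rw [shift_iterate_apply, cat_apply_add]

theorem cat_mem {a x y : Seq M} {k : ℕ} (hy : y ∈ shiftSet a)
    (h : ∀ l < k, LexLE (reflect a) (shift^[l] (cat x k y)) ∧ LexLE (shift^[l] (cat x k y)) a) :
    cat x k y ∈ shiftSet a := by
  intro l
  rcases lt_or_ge l k with hl | hl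
  · exact h l hl
  · obtain ⟨m, rfl⟩ := Nat.exists_eq_add_of_le hl
    rw [← shift_iterate_shift_iterate, shift_cat]
    exact hy m

theorem Agree.shift {k l : ℕ} {x y : Seq M} (h : Agree k x y) :
    Agree (k - l) (shift^[l] x) (shift^[l] y) := by
  intro i hi
  rw [shift_iterate_apply, shift_iterate_apply]
  exact h _ (by omega)

/-! ### The sequences attached to a cut -/

theorem agree_lowerPeriodic (a : Seq M) (n : ℕ) : Agree (n - 1) (lowerPeriodic a n) a := by
  intro i hi
  have h1 : i % n = i := Nat.mod_eq_of_lt (by omega)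
  rw [lowerPeriodic, h1, if_neg (by omega)]

theorem lowerPeriodic_apply_pred {a : Seq M} {n : ℕ} (hn : 0 < n) (h : 0 < a (n - 1)) :
    (lowerPeriodic a n (n - 1)).val + 1 = (a (n - 1)).val := by
  have h1 : (n - 1) % n = n - 1 := Nat.mod_eq_of_lt (by omega)
  rw [lowerPeriodic, h1, if_pos rfl, Fin.val_sub_one_of_ne_zero h.ne']
  have := Fin.lt_def.1 h
  simp at this
  omega

theorem shift_lowerPeriodic (a : Seq M) (n : ℕ) :
    shift^[n] (lowerPeriodic a n) = lowerPeriodic a n := by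
  funext i
  simp [shift_iterate_apply, lowerPeriodic]

theorem lowerPeriodic_congr {a b : Seq M} {n : ℕ} (hn : 0 < n) (h : Agree n a b) :
    lowerPeriodic a n = lowerPeriodic b n := by
  funext i
  rw [lowerPeriodic, lowerPeriodic, h _ (Nat.mod_lt _ hn), h (n - 1) (by omega)]

theorem ltBefore_lowerPeriodic {a : Seq M} {n : ℕ} (hn : 0 < n) (h : 0 < a (n - 1)) :
    LTBefore n (lowerPeriodic a n) a :=
  ⟨n - 1, by omega, agree_lowerPeriodic a n, by
    rw [Fin.lt_def, ← lowerPeriodic_apply_pred hn h]; omega⟩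

theorem upperTail_eq_cat {a : Seq M} {n : ℕ} (h : 0 < a (n - 1)) :
    upperTail a n = cat a n (reflect (lowerPeriodic a n)) := by
  funext i
  rw [upperTail, cat]
  by_cases hi : i < n
  · rw [if_pos hi, if_pos hi]
  · rw [if_neg hi, if_neg hi, reflect, lowerPeriodic, ← Nat.mod_eq_sub_mod (by omega)]
    split_ifs with h1
    · apply Fin.ext
      have h2 := Fin.lt_def.1 h
      have h3 := (a (n - 1)).isLt
      rw [Fin.val_rev, Fin.val_sub_one_of_ne_zero h.ne', Fin.val_add_one_of_lt, Fin.val_rev]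
      · simp at h2
        omega
      · rw [Fin.lt_def, Fin.val_rev]
        simp at h2 ⊢
        omega
    · rfl

theorem IsCut.congr {a b : Seq M} {n : ℕ} (h : IsCut a n) (hab : Agree n a b) : IsCut b n := by
  obtain ⟨h0, h1, h2⟩ := h
  refine ⟨h0, ?_, ?_⟩
  · rwa [← hab (n - 1) (by omega)]
  · rwa [← lowerPeriodic_congr h0 hab]

theorem upperTail_congr {a b : Seq M} {n : ℕ} (h : IsCut a n) (hab : Agree n a b) :
    upperTail a n = upperTail b n := by
  have h' := h.congr hab
  rw [upperTail_eq_cat h.2.1, upperTail_eq_cat h'.2.1, ← lowerPeriodic_congr h.1 hab]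
  funext i
  rw [cat, cat]
  split_ifs with hi
  · exact hab i hi
  · rfl

/-! ### The smallest element of `seqV` -/

/-- The smallest element of `seqV M`: it is `k k k …` for `M = 2 k` and `(k + 1) k (k + 1) k …` for
`M = 2 k + 1`. -/
def IsGolden (a : Seq M) : Prop := shift^[1] a = reflect a ∧ 2 * (a 0).val ≤ M + 1

/-- The overlap criterion below says nothing for n = 1; here the periodic sequence is constant and
must dominate its own reflection. -/
theorem isCut_one_iff {a : Seq M} : IsCut a 1 ↔ M + 2 ≤ 2 * (a 0).val := by
  constructor
  · rintro ⟨-, h1, h2⟩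
    have h3 := le_apply_of_mem h2 0
    have h4 := lowerPeriodic_apply_pred one_pos h1
    simp only [Nat.sub_self] at h4
    omega
  · intro h
    have h1 : 0 < a 0 := by rw [Fin.lt_def, Fin.val_zero]; omega
    refine ⟨one_pos, h1, ?_⟩
    have h4 := lowerPeriodic_apply_pred one_pos h1
    simp only [Nat.sub_self] at h4
    set b := lowerPeriodic a 1 with hb
    have hb1 : shift^[1] b = b := shift_lowerPeriodic a 1
    intro n
    have hbn : shift^[n] b = b := by simpa using shift_iterate_eq_of_mul hb1 n
    rw [hbn]
    refine ⟨?_, LexLE.refl _⟩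
    rcases Nat.lt_or_ge (M - (b 0).val) (b 0).val with h5 | h5
    · exact Or.inr ⟨0, by omega, by rwa [Fin.lt_def, reflect_apply_val]⟩
    · refine Or.inl (Agree.ext_of_periodic one_pos (fun i hi => ?_) ?_ hb1)
      · obtain rfl : i = 0 := by omega
        apply Fin.ext
        rw [reflect_apply_val]
        omega
      · rw [shift_iterate_reflect, hb1]

theorem lt_two_mul_of_not_isGolden {a : Seq M} (ha : a ∈ seqV M) (h : ¬ IsGolden a) :
    M + 1 ≤ 2 * (a 0).val := by
  by_contra hc
  refine h ⟨?_, by omega⟩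
  funext i
  rw [shift_iterate_apply]
  apply Fin.ext
  rw [reflect_apply_val]
  have h1 := apply_le_of_mem ha (1 + i)
  have h2 := le_apply_of_mem ha (1 + i)
  have h3 := apply_le_of_mem ha i
  have h4 := le_apply_of_mem ha i
  omega

/-- Only the digits a_1 and a_1 - 1 are available. If a_2 ≠ a_1, two equal consecutive digits would
violate the upper or the lower bound, so the digits alternate and the sequence is golden. -/
theorem apply_one_eq_of_not_isGolden {a : Seq M} (ha : a ∈ seqV M) (h : ¬ IsGolden a)
    (h0 : 2 * (a 0).val = M + 1) : a 1 = a 0 := by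
  by_contra hc
  have b1 := apply_le_of_mem ha 1
  have b2 := le_apply_of_mem ha 1
  have hne : (a 1).val ≠ (a 0).val := fun h => hc (Fin.ext h)
  refine h ⟨?_, by omega⟩
  funext i
  rw [shift_iterate_apply]
  apply Fin.ext
  rw [reflect_apply_val]
  have h1 := apply_le_of_mem ha (1 + i)
  have h2 := le_apply_of_mem ha (1 + i)
  have h3 := apply_le_of_mem ha i
  have h4 := le_apply_of_mem ha i
  by_contra hne'
  have heq : (a (1 + i)).val = (a i).val := by omega
  rcases (show (a i).val = (a 0).val ∨ (a i).val + 1 = (a 0).val by omega) with h5 | h5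
  · refine LTBefore.not_ge (n := 2) ⟨1, by omega, fun l hl => ?_, ?_⟩ (ha i).2
    · obtain rfl : l = 0 := by omega
      rw [shift_iterate_apply]
      exact Fin.ext h5.symm
    · rw [shift_iterate_apply, Fin.lt_def, add_comm i]
      omega
  · refine LTBefore.not_ge (n := 2) ⟨1, by omega, fun l hl => ?_, ?_⟩ (ha i).1
    · obtain rfl : l = 0 := by omega
      rw [shift_iterate_apply]
      apply Fin.ext
      rw [reflect_apply_val, add_zero]
      omega
    · rw [shift_iterate_apply, Fin.lt_def, reflect_apply_val, add_comm i]
      omega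

/-! ### A criterion for cuts -/

theorem ltBefore_shift_lowerPeriodic {a : Seq M} {n l : ℕ} (h : 0 < a (n - 1)) (hl : l < n) :
    LTBefore (n - l) (shift^[l] (lowerPeriodic a n)) (shift^[l] a) := by
  refine ⟨n - 1 - l, by omega, fun i hi => ?_, ?_⟩
  · rw [shift_iterate_apply, shift_iterate_apply]
    exact agree_lowerPeriodic a n _ (by omega)
  · rw [shift_iterate_apply, shift_iterate_apply, show l + (n - 1 - l) = n - 1 by omega,
      Fin.lt_def, ← lowerPeriodic_apply_pred (by omega) h]
    omega

/-- Given such an overlap, lowering the n-th digit would push this shift of the periodic sequence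
strictly below its reflection. -/
theorem IsCut.not_agree {a : Seq M} {n l : ℕ} (h : IsCut a n) (hl : 0 < l) (hln : l < n) :
    ¬ Agree (n - l) (shift^[l] a) (reflect a) := by
  intro hag
  have h1 := ltBefore_shift_lowerPeriodic h.2.1 hln
  have h2 : LTBefore (n - l) (shift^[l] (lowerPeriodic a n)) (reflect (lowerPeriodic a n)) :=
    h1.congr (fun _ _ => rfl)
      (hag.trans ((agree_lowerPeriodic a n).mono (by omega)).reflect.symm)
  exact h2.not_ge (h.2.2 l).1

/-- Without overlaps, each proper suffix of a_1…a_n lies strictly above the corresponding prefix of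
the reflection. Lowering the last digit by one can at worst create equality; the comparison then
wraps into the next period, where it is the same problem, reflected, at a smaller index. The upper
bounds survive because lowering a digit only helps. -/
theorem isCut_of_forall_not_agree {a : Seq M} {n : ℕ} (ha : a ∈ seqV M)
    (h0 : M + 1 ≤ 2 * (a 0).val) (hn : 2 ≤ n)
    (h : ∀ l, 0 < l → l < n → ¬ Agree (n - l) (shift^[l] a) (reflect a)) : IsCut a n := by
  have hpos : 0 < a (n - 1) := by
    by_contra hc
    refine h (n - 1) (by omega) (by omega) fun i hi => ?_
    obtain rfl : i = 0 := by omega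
    rw [shift_iterate_apply]
    apply Fin.ext
    rw [reflect_apply_val]
    have h1 := le_apply_of_mem ha (n - 1)
    rw [Fin.lt_def, Fin.val_zero] at hc
    change (a (n - 1)).val = M - (a 0).val
    omega
  refine ⟨by omega, hpos, ?_⟩
  have hag := agree_lowerPeriodic a n
  have hpred := lowerPeriodic_apply_pred (by omega) hpos
  have hbn := shift_lowerPeriodic a n
  have hlt := fun l hl => ltBefore_shift_lowerPeriodic (n := n) (l := l) hpos hl
  set b := lowerPeriodic a n
  have hb0 : b 0 = a 0 := hag 0 (by omega)
  -- The lower bound, as a statement about the first difference t, so that induction on t can handle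
  -- the wrap-around.
  have key : ∀ t m, m < n → (∀ i < t, b (m + i) = Fin.rev (b i)) → ¬ b (m + t) < Fin.rev (b t) := by
    intro t
    induction t using Nat.strong_induction_on with
    | _ t ih =>
      intro m hm h1 h2
      rcases Nat.eq_zero_or_pos m with rfl | hm0
      · rcases Nat.eq_zero_or_pos t with rfl | ht
        · rw [hb0, Fin.lt_def, Fin.val_rev] at h2
          omega
        · have := congrArg Fin.val (h1 0 ht)
          rw [Fin.val_rev] at this
          simp only [Nat.zero_add, hb0] at this
          omega
      · obtain ⟨s, hs, hs1, hs2⟩ := ((ha m).1.agree_or_ltBefore (n - m)).resolve_left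
          fun hx => h m hm0 hm hx.symm
        rw [shift_iterate_apply, ← hag.reflect s (by omega)] at hs2
        have hlow : ∀ i < s, b (m + i) = Fin.rev (b i) := by
          intro i hi
          have := hs1 i hi
          rw [shift_iterate_apply, ← hag.reflect i (by omega), ← hag (m + i) (by omega)] at this
          exact this.symm
        rw [Fin.lt_def, reflect_apply_val] at hs2
        rw [Fin.lt_def, Fin.val_rev] at h2
        rcases lt_trichotomy t s with hts | rfl | hts
        · have := congrArg Fin.val (hlow t hts)
          rw [Fin.val_rev] at this
          omega
        · rcases Nat.lt_or_ge (m + t) (n - 1) with h3 | h3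
          · rw [← hag _ h3] at hs2
            omega
          · rw [show m + t = n - 1 by omega] at h2 hs2
            omega
        · have h4 := congrArg Fin.val (h1 s hts)
          rw [Fin.val_rev] at h4
          rcases Nat.lt_or_ge (m + s) (n - 1) with h3 | h3
          · rw [← hag _ h3] at hs2
            omega
          -- The agreement runs through the lowered digit, to the end of the period. Reflecting the
          -- remaining comparison turns shift m into shift n - m and t into t - (n - m).
          · have hb' : ∀ i, b (m + ((n - m) + i)) = b i := by
              intro i
              rw [show m + ((n - m) + i) = n + i by omega, ← shift_iterate_apply n b i, hbn]
            obtain ⟨t', rfl⟩ : ∃ t', t = (n - m) + t' := ⟨t - (n - m), by omega⟩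
            refine ih t' (by omega) (n - m) (by omega) (fun i hi => ?_) ?_
            · rw [← hb' i, h1 _ (by omega), Fin.rev_rev]
            · rw [hb'] at h2
              rw [Fin.lt_def, Fin.val_rev]
              have := (b t').isLt
              have := (b (n - m + t')).isLt
              omega
  intro m
  have hmod : shift^[m] b = shift^[m % n] b := by
    funext i
    rw [shift_iterate_apply, shift_iterate_apply]
    conv_lhs => rw [← Nat.div_add_mod m n, add_assoc, apply_add_mul hbn]
  rw [hmod]
  have hmn : m % n < n := Nat.mod_lt _ (by omega)
  generalize m % n = m at hmn
  constructor
  · by_contra hc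
    obtain ⟨t, h1, h2⟩ := not_lexLE.1 hc
    refine key t m hmn (fun i hi => ?_) ?_
    · have := h1 i hi
      rwa [shift_iterate_apply] at this
    · rwa [shift_iterate_apply] at h2
  · rcases Nat.eq_zero_or_pos m with rfl | hm0
    · exact LexLE.refl _
    · exact (((hlt m hmn).trans_le (ha m).2).congr (fun _ _ => rfl)
        (hag.mono (by omega)).symm).le

theorem IsGolden.not_isCut {a : Seq M} (h : IsGolden a) (n : ℕ) : ¬ IsCut a n := by
  intro hc
  rcases (show n = 0 ∨ n = 1 ∨ 1 < n by omega) with rfl | rfl | hn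
  · exact absurd hc.1 (lt_irrefl 0)
  · have h1 := isCut_one_iff.1 hc
    have := h.2
    omega
  · refine hc.not_agree one_pos hn ?_
    rw [h.1]
    exact fun _ _ => rfl

theorem IsGolden.isIrreducibleSeq {a : Seq M} (ha : a ∈ seqV M) (h : IsGolden a) :
    IsIrreducibleSeq a :=
  ⟨ha, fun j hj => absurd hj (h.not_isCut j)⟩

/-! ### Existence of cuts -/

/-- For the least i with σ^i(a) equal to the reflection, a and U_i share i digits, after which they
continue with the reflections of a and of the smaller sequence (a_1…a_i⁻)^∞. Reflection reverses the
order. -/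
theorem exists_isCut_of_shift_eq_reflect {a : Seq M} (ha : a ∈ seqV M) (hg : ¬ IsGolden a) {j : ℕ}
    (hj : 0 < j) (h : shift^[j] a = reflect a) :
    ∃ i ≤ j, IsCut a i ∧ LexLT a (upperTail a i) := by
  classical
  have hex : ∃ i, 0 < i ∧ shift^[i] a = reflect a := ⟨j, hj, h⟩
  have h0 := lt_two_mul_of_not_isGolden ha hg
  set i := Nat.find hex with hi
  obtain ⟨hi0, hi1⟩ := Nat.find_spec hex
  rw [← hi] at hi0 hi1
  have hcut : IsCut a i := by
    rcases (show i = 1 ∨ 2 ≤ i by omega) with h1 | h2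
    · rw [h1] at hi1 ⊢
      rw [isCut_one_iff]
      by_contra hc
      exact hg ⟨hi1, by omega⟩
    · refine isCut_of_forall_not_agree ha h0 h2 fun l hl hli hag => ?_
      obtain ⟨p, hp⟩ := Nat.exists_eq_add_of_lt hli
      have hp' : i - l = p + 1 := by omega
      -- An overlap starting at l would force σ^(i-l)(a) = a and then σ^l(a) equal to the
      -- reflection, against minimality of i.
      rw [hp'] at hag
      have h3 := hag.symm.shift_le (ha l).1
      rw [shift_iterate_shift_iterate, show l + (p + 1) = i by omega, hi1, shift_iterate_reflect]
        at h3
      have h4 := h3.reflect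
      rw [reflect_reflect, reflect_reflect] at h4
      have h5 : shift^[p + 1] a = a := (ha _).2.antisymm h4
      have h6 : shift^[l] a = reflect a := by
        refine hag.ext_of_shift ?_
        rw [shift_iterate_shift_iterate, show l + (p + 1) = i by omega, hi1,
          shift_iterate_reflect, h5]
      exact Nat.find_min hex hli ⟨hl, h6⟩
  refine ⟨i, Nat.find_min' hex ⟨hj, h⟩, hcut, ?_⟩
  rw [upperTail_eq_cat hcut.2.1]
  have hlt := (ltBefore_lowerPeriodic hcut.1 hcut.2.1).reflect
  obtain ⟨t, ht, h1, h2⟩ := hlt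
  refine ⟨i + t, fun s hs => ?_, ?_⟩
  · rcases lt_or_ge s i with hsi | hsi
    · exact (agree_cat _ _ _ s hsi).symm
    · obtain ⟨r, rfl⟩ := Nat.exists_eq_add_of_le hsi
      rw [cat_apply_add, ← h1 r (by omega), ← hi1, shift_iterate_apply]
  · rw [cat_apply_add]
    have := congrFun hi1 t
    rw [shift_iterate_apply] at this
    rwa [this]

/-- With no cuts beyond m, every longer prefix has an overlap. The earliest overlap start l for the
prefix of length m + 2 then persists for all lengths. -/
theorem exists_isCut_gt {a : Seq M} (hirr : IsIrreducibleSeq a) (hg : ¬ IsGolden a) (m : ℕ) :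
    ∃ n > m, IsCut a n := by
  classical
  have ha := hirr.1
  by_contra! hc
  have h0 := lt_two_mul_of_not_isGolden ha hg
  have hbad : ∀ n, m < n → 2 ≤ n →
      ∃ l, 0 < l ∧ l < n ∧ Agree (n - l) (shift^[l] a) (reflect a) := by
    intro n hn hn2
    by_contra! h
    exact hc n hn (isCut_of_forall_not_agree ha h0 hn2 h)
  have hex := hbad (m + 2) (by omega) (by omega)
  set l := Nat.find hex with hl
  obtain ⟨hl0, hl1, hl2⟩ := Nat.find_spec hex
  rw [← hl] at hl0 hl1 hl2
  have key : ∀ d, Agree (m + 2 + d - l) (shift^[l] a) (reflect a) := by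
    intro d
    induction d with
    | zero => exact hl2
    | succ d ih =>
      set n := m + 2 + d with hn
      obtain ⟨l', hl'0, hl'1, hl'2⟩ := hbad (n + 1) (by omega) (by omega)
      have hll' : l ≤ l' := by
        rcases lt_or_ge l' (m + 2) with h1 | h1
        · exact Nat.find_min' hex ⟨hl'0, h1, hl'2.mono (by omega)⟩
        · omega
      rcases hll'.eq_or_lt with heq | hlt
      · rw [show m + 2 + (d + 1) = n + 1 by omega, heq]
        exact hl'2
      intro i hi
      rcases (show i < n - l ∨ i = n - l by omega) with h1 | rfl
      · exact ih i h1
      by_contra hne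
      have hgt : (reflect a (n - l)).val < (a n).val := by
        obtain ⟨t, ht, h1, h2⟩ := ((ha l).1.agree_or_ltBefore (n + 1 - l)).resolve_left
          fun hx => hne (hx (n - l) (by omega)).symm
        rcases (show t < n - l ∨ t = n - l by omega) with h3 | rfl
        · rw [ih t h3] at h2
          exact absurd h2 (lt_irrefl _)
        · rw [shift_iterate_apply, show l + (n - l) = n by omega] at h2
          exact h2
      have h1 := hl'2 (n - l') (by omega)
      rw [shift_iterate_apply, show l' + (n - l') = n by omega] at h1
      rw [h1, reflect_apply_val, reflect_apply_val] at hgt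
      -- If the overlap at l broke at index n, comparing it with the later overlap at l' would make
      -- σ^(l'-l)(a) exceed a at index n - l'.
      refine LTBefore.not_ge (n := n - l' + 1) ⟨n - l', by omega, fun t ht => ?_, ?_⟩
        (ha (l' - l)).2
      · have h2 := hl'2 t (by omega)
        have h3 := ih (l' - l + t) (by omega)
        rw [shift_iterate_apply] at h2 h3
        rw [show l + (l' - l + t) = l' + t by omega, h2] at h3
        rw [shift_iterate_apply]
        exact Fin.rev_injective h3
      · rw [shift_iterate_apply, show l' - l + (n - l') = n - l by omega, Fin.lt_def]
        omega
  have heq : shift^[l] a = reflect a := by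
    funext i
    exact key (l + i) i (by omega)
  obtain ⟨i, -, hi1, hi2⟩ := exists_isCut_of_shift_eq_reflect ha hg hl0 heq
  exact not_lexLE.2 (hirr.2 i hi1) hi2.le

/-! ### Irreducible approximations -/

theorem LexLE.agree_of_sandwich {k : ℕ} {x y z : Seq M} (h : LexLE x y) (h' : LexLE y z)
    (hag : Agree k x z) : Agree k x y := by
  refine (h.agree_or_ltBefore k).resolve_right fun hlt => ?_
  exact (hlt.trans_le h').not_agree hag

/-- A witness j of reducibility puts σ^j(c) between two sequences agreeing on j - 1 digits. For j >
n periodicity upgrades this to σ^j(c) being the reflection of c, and j mod n yields a smaller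
witness; j = n contradicts the size of the first digit. -/
theorem exists_isCut_le_upperTail {c : Seq M} (hc : c ∈ seqV M) {n : ℕ} (hn : 0 < n)
    (hper : shift^[n] c = c) (hred : ¬ IsIrreducibleSeq c) :
    ∃ j < n, IsCut c j ∧ LexLE c (upperTail c j) := by
  have hg : ¬ IsGolden c := fun h => hred (h.isIrreducibleSeq hc)
  have h0 := lt_two_mul_of_not_isGolden hc hg
  obtain ⟨j, hj, hle⟩ : ∃ j, IsCut c j ∧ LexLE c (upperTail c j) := by
    by_contra! h
    exact hred ⟨hc, fun j hj => not_lexLE.1 (h j hj)⟩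
  rcases lt_or_ge j n with hjn | hjn
  · exact ⟨j, hjn, hj, hle⟩
  rw [upperTail_eq_cat hj.2.1] at hle
  have hle' := (agree_cat c j (reflect (lowerPeriodic c j))).symm.shift_le hle
  rw [shift_cat] at hle'
  have hag := (hc j).1.agree_of_sandwich hle' (agree_lowerPeriodic c j).symm.reflect
  rcases (show n ≤ j - 1 ∨ j = n by omega) with h1 | rfl
  · have heq : shift^[j] c = reflect c := by
      refine ((hag.mono h1).ext_of_periodic hn ?_ ?_).symm
      · rw [shift_iterate_reflect, hper]
      · rw [shift_iterate_shift_iterate, add_comm, ← shift_iterate_shift_iterate, hper]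
    have heq' : shift^[j % n] c = reflect c := by
      rw [← heq]
      funext i
      rw [shift_iterate_apply, shift_iterate_apply]
      conv_rhs => rw [← Nat.div_add_mod j n, add_assoc, apply_add_mul hper]
    have hpos : 0 < j % n := by
      by_contra hz
      rw [show j % n = 0 by omega] at heq'
      have := congrArg Fin.val (congrFun heq' 0)
      rw [reflect_apply_val] at this
      simp only [Function.iterate_zero, id_eq] at this
      omega
    obtain ⟨i, hi, hi1, hi2⟩ := exists_isCut_of_shift_eq_reflect hc hg hpos heq'
    exact ⟨i, hi.trans_lt (Nat.mod_lt _ hn), hi1, hi2.le⟩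
  · exfalso
    rw [hper] at hag hle'
    rcases (show j = 1 ∨ 0 < j - 1 by omega) with rfl | h1
    · have h2 := isCut_one_iff.1 hj
      have h3 := lowerPeriodic_apply_pred hj.1 hj.2.1
      have h4 := Fin.le_def.1 hle'.apply_zero_le
      rw [reflect_apply_val] at h4
      simp only [Nat.sub_self] at h3
      omega
    · have := congrArg Fin.val (hag 0 h1)
      rw [reflect_apply_val] at this
      omega

/-- The least witness j for the reducibility of b = (a_1…a_n⁻)^∞ works. If d = (b_1…b_j⁻)^∞ were
reducible with witness i < j, then d ≼ U_i ≺ b ≼ U_j, with U formed from b. So U_i starts with the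
first j digits of b or of d, and its tail would leave the range allowed by (b_1…b_i⁻)^∞ ≺ d. -/
theorem exists_isIrreducibleSeq_le_upperTail {a : Seq M} {n : ℕ} (hn : IsCut a n)
    (hred : ¬ IsIrreducibleSeq (lowerPeriodic a n)) :
    ∃ j < n, IsCut a j ∧ LexLE (lowerPeriodic a n) (upperTail a j) ∧
      IsIrreducibleSeq (lowerPeriodic a j) := by
  classical
  have hab := agree_lowerPeriodic a n
  have hb := hn.2.2
  obtain ⟨j₀, hj₀n, hj₀⟩ :=
    exists_isCut_le_upperTail hb hn.1 (shift_lowerPeriodic a n) hred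
  set b := lowerPeriodic a n with hbdef
  have hex : ∃ j, IsCut b j ∧ LexLE b (upperTail b j) := ⟨j₀, hj₀⟩
  set j := Nat.find hex with hj
  obtain ⟨hj1, hj2⟩ := Nat.find_spec hex
  have hjn : j < n := (Nat.find_min' hex hj₀).trans_lt hj₀n
  rw [← hj] at hj1 hj2
  have haj : Agree j b a := hab.mono (by omega)
  refine ⟨j, hjn, hj1.congr haj, by rwa [← upperTail_congr hj1 haj], ?_⟩
  rw [← lowerPeriodic_congr hj1.1 haj]
  by_contra hred'
  obtain ⟨i, hij, hi1, hi2⟩ :=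
    exists_isCut_le_upperTail hj1.2.2 hj1.1 (shift_lowerPeriodic b j) hred'
  have hdb := agree_lowerPeriodic b j
  have hpred := lowerPeriodic_apply_pred hj1.1 hj1.2.1
  have hdper := shift_lowerPeriodic b j
  have hUj : shift^[j] (upperTail b j) = reflect (lowerPeriodic b j) := by
    rw [upperTail_eq_cat hj1.2.1, shift_cat]
  have hUja : Agree j b (upperTail b j) := by
    rw [upperTail_eq_cat hj1.2.1]
    exact (agree_cat _ _ _).symm
  set d := lowerPeriodic b j
  have hib : IsCut b i := hi1.congr (hdb.mono (by omega))
  rw [upperTail_congr hi1 (hdb.mono (by omega))] at hi2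
  have hlt : LexLT (upperTail b i) b := by
    rw [← not_lexLE]
    exact fun hle => Nat.find_min hex hij ⟨hib, hle⟩
  have hUi : shift^[j] (upperTail b i) = shift^[j - i] (reflect (lowerPeriodic b i)) := by
    rw [upperTail_eq_cat hib.2.1, show j = i + (j - i) by omega,
      ← shift_iterate_shift_iterate, shift_cat, show i + (j - i) - i = j - i by omega]
  have hed : LTBefore i (lowerPeriodic b i) d :=
    (ltBefore_lowerPeriodic hib.1 hib.2.1).congr (fun _ _ => rfl) (hdb.mono (by omega)).symm
  have hemem := reflect_mem (mem_seqV_iff.1 hib.2.2) (j - i)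
  rw [← hUi] at hemem
  by_cases hag : Agree j (upperTail b i) b
  · have h1 := hag.shift_le hlt.le
    have h2 := hUja.shift_le hj2
    rw [hUj] at h2
    exact hed.reflect.not_ge (hemem.1.trans (h1.trans h2))
  · obtain ⟨t, ht, ht1, ht2⟩ := (hlt.agree_or_ltBefore j).resolve_left hag
    have hs := hi2.agree_of_sandwich hlt.le hdb
    have htj : t = j - 1 := by
      by_contra hne
      rw [← hs t (by omega), hdb t (by omega)] at ht2
      exact lt_irrefl _ ht2
    subst htj
    have hdU : Agree j d (upperTail b i) := by
      refine (hi2.agree_or_ltBefore j).resolve_right ?_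
      rintro ⟨s, hs1, -, hs2⟩
      rcases (show s < j - 1 ∨ s = j - 1 by omega) with h1 | rfl
      · rw [hs s h1] at hs2
        exact lt_irrefl _ hs2
      · rw [Fin.lt_def] at hs2 ht2
        omega
    have h1 := hdU.shift_le hi2
    rw [hdper] at h1
    exact hed.not_ge (h1.trans hemem.2)

theorem exists_isIrreducibleSeq_lowerPeriodic {a : Seq M} (hirr : IsIrreducibleSeq a)
    (hg : ¬ IsGolden a) (K : ℕ) :
    ∃ n > K, IsCut a n ∧ IsIrreducibleSeq (lowerPeriodic a n) := by
  by_contra! hc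
  choose T hT using fun j (hj : IsCut a j) => (hirr.2 j hj).exists_ltBefore
  classical
  set T' := (Finset.range (K + 1)).sup fun j => if hj : IsCut a j then T j hj else 0 with hT'
  have hT'' : ∀ j (hj : IsCut a j), j ≤ K → T j hj ≤ T' := by
    intro j hj hjK
    have := Finset.le_sup (f := fun j => if hj : IsCut a j then T j hj else 0)
      (Finset.mem_range.2 (Nat.lt_succ_of_le hjK))
    simpa [hj] using this
  -- The approximation at such n agrees with a far enough to exceed every U_j with j ≤ K.
  obtain ⟨n, hn, hcut⟩ := exists_isCut_gt hirr hg (max K T' + 1)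
  have hK := le_max_left K T'
  have hT1 := le_max_right K T'
  obtain ⟨j, -, hj1, hj2, hj3⟩ :=
    exists_isIrreducibleSeq_le_upperTail hcut (hc n (by omega) hcut)
  have hjK : j ≤ K := by
    by_contra hlt
    exact hc j (by omega) hj1 hj3
  have h1 := (hT j hj1).mono (show T j hj1 ≤ n - 1 by have := hT'' j hj1 hjK; omega)
  exact (h1.congr (fun _ _ => rfl) (agree_lowerPeriodic a n).symm).not_ge hj2

/-! ### Transitivity -/

/-- The word `w` occurs in `x` at index `k`. -/
def IsFactorAt (w : Word M) (x : Seq M) (k : ℕ) : Prop :=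
  ∀ (i : ℕ) (hi : i < w.length), w[i] = x (k + i)

theorem IsFactorAt.append {u v : Word M} {x : Seq M} {k : ℕ} (hu : IsFactorAt u x k)
    (hv : IsFactorAt v x (k + u.length)) : IsFactorAt (u ++ v) x k := by
  intro i hi
  rw [List.getElem_append]
  split_ifs with h
  · exact hu i h
  · rw [hv, add_assoc]
    congr 2
    omega

theorem isFactorAt_ofFn (x : Seq M) (k n : ℕ) :
    IsFactorAt (List.ofFn fun i : Fin n => x (k + i)) x k := by
  intro i hi
  simp

/-- Every element of `shiftSet a` can be reached from the first `k` digits of `x`. -/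
def Reaches (a x : Seq M) (k : ℕ) : Prop :=
  ∀ y ∈ shiftSet a, ∃ z ∈ shiftSet a, ∃ N ≥ k, Agree k z x ∧ shift^[N] z = y

theorem isTransitive_of_reaches {a : Seq M} (h : ∀ x ∈ shiftSet a, ∀ k, Reaches a x k) :
    IsTransitive (shiftSet a) := by
  rintro u ⟨x, hx, p, hp⟩ v ⟨y, hy, r, hr⟩
  obtain ⟨z, hz, N, hN, hzx, hzy⟩ :=
    h _ (shift_iterate_mem hx p) u.length _ (shift_iterate_mem hy r)
  have hu : IsFactorAt u z 0 := by
    intro i hi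
    rw [hp i hi, zero_add, hzx i hi, shift_iterate_apply]
  have hw := isFactorAt_ofFn z u.length (N - u.length)
  have hv : IsFactorAt v z N := by
    intro i hi
    rw [hr i hi, ← shift_iterate_apply r y i, ← hzy, shift_iterate_apply]
  refine ⟨_, ⟨z, hz, _, hw⟩, z, hz, 0, (hu.append ?_).append ?_⟩
  · rwa [zero_add]
  · rwa [List.length_append, List.length_ofFn, zero_add,
      show u.length + (N - u.length) = N by omega]

theorem Reaches.mono {a x : Seq M} {m k : ℕ} (h : Reaches a x k) (hmk : m ≤ k) :
    Reaches a x m := by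
  intro y hy
  obtain ⟨z, hz, N, hN, h1, h2⟩ := h y hy
  exact ⟨z, hz, N, by omega, h1.mono hmk, h2⟩

theorem Reaches.congr {a x x' : Seq M} {k : ℕ} (h : Reaches a x k) (hx : Agree k x x') :
    Reaches a x' k := by
  intro y hy
  obtain ⟨z, hz, N, hN, h1, h2⟩ := h y hy
  exact ⟨z, hz, N, hN, h1.trans hx, h2⟩

theorem Reaches.reflect {a x : Seq M} {k : ℕ} (h : Reaches a x k) : Reaches a (reflect x) k := by
  intro y hy
  obtain ⟨z, hz, N, hN, h1, h2⟩ := h _ (reflect_mem hy)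
  exact ⟨_, reflect_mem hz, N, hN, h1.reflect, by
    rw [shift_iterate_reflect, h2, reflect_reflect]⟩

/-- By `hmin`, the bounds at positions before l are already strict inside the first k digits, so any
admissible continuation from l can be glued on. -/
theorem Reaches.of_shift {a x : Seq M} {k l : ℕ} (hx : x ∈ shiftSet a) (hl : l ≤ k)
    (h : Reaches a (shift^[l] x) (k - l))
    (hmin : ∀ m < l, ¬ Agree (k - m) (shift^[m] x) a ∧
      ¬ Agree (k - m) (shift^[m] x) (SymShift.reflect a)) : Reaches a x k := by
  intro y hy
  obtain ⟨z, hz, N, hN, h1, h2⟩ := h y hy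
  have hag : Agree k (cat x l z) x := by
    intro i hi
    rcases lt_or_ge i l with h3 | h3
    · exact agree_cat x l z i h3
    · obtain ⟨j, rfl⟩ := Nat.exists_eq_add_of_le h3
      rw [cat_apply_add, h1 j (by omega), shift_iterate_apply]
  refine ⟨cat x l z, cat_mem hz fun m hm => ?_, l + N, by omega, hag, ?_⟩
  · have h3 := (hag.shift (l := m)).symm
    constructor
    · refine ((((hx m).1.agree_or_ltBefore (k - m)).resolve_left ?_).congr
        (fun _ _ => rfl) h3).le
      exact fun hx => (hmin m hm).2 hx.symm
    · exact ((((hx m).2.agree_or_ltBefore (k - m)).resolve_left (hmin m hm).1).congr h3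
        (fun _ _ => rfl)).le
  · rw [← shift_iterate_shift_iterate, shift_cat, h2]

/-- Take the earliest suffix that is a prefix of a or of its reflection; earlier positions impose
nothing, and the reflected case follows by symmetry. -/
theorem Reaches.of_forall {a x : Seq M} {k : ℕ} (hx : x ∈ shiftSet a)
    (h : ∀ l < k,
      (Agree (k - l) (shift^[l] x) a ∨ Agree (k - l) (shift^[l] x) (SymShift.reflect a)) →
      Reaches a a (k - l)) : Reaches a x k := by
  classical
  by_cases hex : ∃ l, l < k ∧
    (Agree (k - l) (shift^[l] x) a ∨ Agree (k - l) (shift^[l] x) (SymShift.reflect a))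
  · obtain ⟨h1, h2⟩ := Nat.find_spec hex
    refine Reaches.of_shift hx h1.le ?_ fun m hm => ?_
    · rcases h2 with h3 | h3
      · exact (h _ h1 (Or.inl h3)).congr h3.symm
      · exact (h _ h1 (Or.inr h3)).reflect.congr h3.symm
    · have := Nat.find_min hex hm
      push Not at this
      exact this (by omega)
  · push Not at hex
    refine Reaches.of_shift hx le_rfl ?_ hex
    intro y hy
    exact ⟨y, hy, 0, by omega, fun i hi => by omega, rfl⟩

theorem LTBefore.of_shift {p l : ℕ} {x y : Seq M} (h : Agree p x y)
    (h' : LTBefore l (shift^[p] x) (shift^[p] y)) : LTBefore (p + l) x y := by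
  obtain ⟨t, ht, h1, h2⟩ := h'
  refine ⟨p + t, by omega, fun i hi => ?_, ?_⟩
  · rcases lt_or_ge i p with h3 | h3
    · exact h i h3
    · obtain ⟨j, rfl⟩ := Nat.exists_eq_add_of_le h3
      have := h1 j (by omega)
      rwa [shift_iterate_apply, shift_iterate_apply] at this
  · rwa [shift_iterate_apply, shift_iterate_apply] at h2

/-- Base case in which 1 is not a cut. A sequence starting with a smaller digit may follow a_1
directly; otherwise the digit M - a_1 is inserted between. -/
theorem reaches_one {a : Seq M} (h0 : 2 * (a 0).val = M + 1)
    (h1 : a 1 = a 0) : Reaches a a 1 := by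
  have key : ∀ y ∈ shiftSet a, (y 0).val < (a 0).val →
      ∃ z ∈ shiftSet a, Agree 1 z a ∧ shift^[1] z = y := by
    intro y hy hy0
    refine ⟨cat a 1 y, cat_mem hy fun l hl => ?_, agree_cat a 1 y, shift_cat a 1 y⟩
    obtain rfl : l = 0 := by omega
    have e0 : cat a 1 y 0 = a 0 := agree_cat a 1 y 0 one_pos
    have e1 : cat a 1 y 1 = y 0 := cat_apply_add a 1 y 0
    refine ⟨LTBefore.le (n := 1) ⟨0, one_pos, by simp, ?_⟩,
      LTBefore.le (n := 2) ⟨1, by omega, fun i hi => ?_, ?_⟩⟩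
    · simp only [Function.iterate_zero, id_eq, e0]
      rw [Fin.lt_def, reflect_apply_val]
      omega
    · obtain rfl : i = 0 := by omega
      exact e0
    · simp only [Function.iterate_zero, id_eq, e1, h1]
      exact hy0
  intro y hy
  rcases (apply_le_of_mem hy 0).lt_or_eq with hlt | heq
  · obtain ⟨z, hz, h2, h3⟩ := key y hy hlt
    exact ⟨z, hz, 1, le_rfl, h2, h3⟩
  · have e0 : (cat (reflect a) 1 y 0).val = M - (a 0).val := by
      rw [agree_cat (reflect a) 1 y 0 one_pos, reflect_apply_val]
    have e1 : cat (reflect a) 1 y 1 = y 0 := cat_apply_add (reflect a) 1 y 0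
    have hmem : cat (reflect a) 1 y ∈ shiftSet a := by
      refine cat_mem hy fun l hl => ?_
      obtain rfl : l = 0 := by omega
      refine ⟨LTBefore.le (n := 2) ⟨1, by omega, fun i hi => ?_, ?_⟩,
        LTBefore.le (n := 1) ⟨0, one_pos, by simp, ?_⟩⟩
      · obtain rfl : i = 0 := by omega
        exact (agree_cat (reflect a) 1 y 0 one_pos).symm
      · simp only [Function.iterate_zero, id_eq, e1]
        rw [Fin.lt_def, reflect_apply_val, h1]
        omega
      · simp only [Function.iterate_zero, id_eq]
        rw [Fin.lt_def, e0]
        omega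
    obtain ⟨z, hz, h2, h3⟩ := key _ hmem (by rw [e0]; omega)
    refine ⟨z, hz, 2, by omega, h2, ?_⟩
    rw [show (2 : ℕ) = 1 + 1 from rfl, ← shift_iterate_shift_iterate, h3, shift_cat]

theorem IsCut.not_agree_lowerPeriodic {a : Seq M} (ha : a ∈ seqV M) {n r : ℕ} (h : IsCut a n)
    (hr : 0 < r) (hrn : r < n) : ¬ Agree r (shift^[n - r] (lowerPeriodic a n)) a := by
  intro hag
  have h1 := ltBefore_shift_lowerPeriodic (l := n - r) h.2.1 (by omega)
  rw [show n - (n - r) = r by omega] at h1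
  exact (h1.congr hag (fun _ _ => rfl)).not_ge (ha (n - r)).2

/-- A reflected overlap inside a_1…a_r would, reflected once more, be a suffix of a_1…a_n⁻ that is a
prefix of a, which is impossible. -/
theorem IsCut.of_agree_lowerPeriodic {a : Seq M} (ha : a ∈ seqV M)
    (h0 : M + 1 ≤ 2 * (a 0).val) {n r : ℕ} (h : IsCut a n) (hr : 2 ≤ r) (hrn : r < n)
    (hag : Agree r (shift^[n - r] (lowerPeriodic a n)) (reflect a)) : IsCut a r := by
  refine isCut_of_forall_not_agree ha h0 hr fun i hi hir hag' => ?_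
  refine h.not_agree_lowerPeriodic ha (r := r - i) (by omega) (by omega) ?_
  have h1 := hag.shift (l := i)
  rw [shift_iterate_shift_iterate, show n - r + i = n - (r - i) by omega,
    shift_iterate_reflect] at h1
  have h2 := hag'.reflect
  rw [reflect_reflect] at h2
  exact h1.trans h2

/-- The delicate case is a suffix of a_1…a_n that is a prefix of a: what follows is then the
reflection of (a_1…a_n⁻)^∞, at most σ^(n-l) of that sequence and hence visibly below σ^(n-l)(a). -/
theorem IsCut.ltBefore_shift_upperTail {a : Seq M} (ha : a ∈ seqV M) {n l : ℕ} (h : IsCut a n)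
    (hl : 0 < l) : LTBefore n (reflect a) (shift^[l] (upperTail a n)) ∧
      LTBefore n (shift^[l] (upperTail a n)) a := by
  have hba := ltBefore_lowerPeriodic h.1 h.2.1
  rw [upperTail_eq_cat h.2.1]
  rcases lt_or_ge l n with hln | hln
  · have hag := ((agree_cat a n (reflect (lowerPeriodic a n))).shift (l := l)).symm
    constructor
    · refine (LTBefore.congr (((ha l).1.agree_or_ltBefore (n - l)).resolve_left ?_)
        (fun _ _ => rfl) hag).mono (by omega)
      exact fun hx => h.not_agree hl hln hx.symm
    · rcases (ha l).2.agree_or_ltBefore (n - l) with h1 | h1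
      · rw [show n = n - l + l by omega]
        refine LTBefore.of_shift ?_ ?_
        · rw [show n - l + l = n by omega]
          exact hag.symm.trans h1
        · rw [show n - l + l = n by omega, shift_iterate_shift_iterate,
            show l + (n - l) = n by omega, shift_cat]
          have h2 := ltBefore_shift_lowerPeriodic (l := n - l) h.2.1 (by have := h.1; omega)
          rw [show n - (n - l) = l by omega] at h2
          exact (h.2.2 (n - l)).1.trans_ltBefore h2
      · exact (h1.congr hag (fun _ _ => rfl)).mono (by omega)
  · obtain ⟨m, rfl⟩ := Nat.exists_eq_add_of_le hln
    rw [← shift_iterate_shift_iterate, shift_cat]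
    have hm := reflect_mem (mem_seqV_iff.1 h.2.2) m
    exact ⟨hba.reflect.trans_le hm.1, hm.2.trans_ltBefore hba⟩

/-- Irreducibility makes U_n admissible and visibly smaller than a, so following it releases the
constraint imposed by a_1…a_n and leaves only shorter ones. -/
theorem reaches_of_isCut {a : Seq M} (hirr : IsIrreducibleSeq a) (hg : ¬ IsGolden a) (n : ℕ)
    (hn : IsCut a n) : Reaches a a n := by
  have ha := hirr.1
  have h0 := lt_two_mul_of_not_isGolden ha hg
  induction n using Nat.strong_induction_on with
  | _ n ih =>
    obtain ⟨T, hT⟩ := (hirr.2 n hn).exists_ltBefore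
    have hTpos : 0 < T := by
      obtain ⟨t, ht, -⟩ := hT
      omega
    have hUcat := upperTail_eq_cat hn.2.1
    have hU0 : upperTail a n 0 = a 0 := by
      rw [hUcat]
      exact agree_cat a n _ 0 hn.1
    have hlow : LTBefore 1 (reflect a) (upperTail a n) := by
      refine ⟨0, one_pos, by simp, ?_⟩
      rw [hU0, Fin.lt_def, reflect_apply_val]
      omega
    have hUmem : upperTail a n ∈ shiftSet a := by
      intro l
      rcases Nat.eq_zero_or_pos l with rfl | hl
      · exact ⟨hlow.le, hT.le⟩
      · have := hn.ltBefore_shift_upperTail ha hl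
        exact ⟨this.1.le, this.2.le⟩
    obtain ⟨T, rfl⟩ : ∃ T', T = T' + 1 := ⟨T - 1, by omega⟩
    have hTn : T + 1 ≤ n * (T + 1) := Nat.le_mul_of_pos_left _ hn.1
    have hnn : n ≤ n * (T + 1) := Nat.le_mul_of_pos_right _ hTpos
    -- With T + 1 blocks after a_1…a_n, the whole word is long enough to show U_n ≺ a, and every
    -- suffix starting at or before n * (T + 1) has length at least n, enough for the strict bounds
    -- on shifts of U_n.
    suffices hU : Reaches a (upperTail a n) (n + n * (T + 1)) by
      refine (hU.mono (by omega)).congr ?_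
      rw [hUcat]
      exact agree_cat a n _
    refine Reaches.of_forall hUmem fun l hl hor => ?_
    rcases Nat.lt_or_ge (n * (T + 1)) l with hl' | hl'
    · obtain ⟨r, hr⟩ : ∃ r, l = n + n * (T + 1) - r ∧ 0 < r ∧ r < n :=
        ⟨n + n * (T + 1) - l, by omega, by omega, by omega⟩
      obtain ⟨rfl, hr0, hrn⟩ := hr
      have hb := shift_lowerPeriodic a n
      have hsh : shift^[n + n * (T + 1) - r] (upperTail a n) =
          reflect (shift^[n - r] (lowerPeriodic a n)) := by
        have e : n + n * (T + 1) - r = n + (n * T + (n - r)) := by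
          rw [Nat.mul_add, mul_one]
          omega
        rw [e, ← shift_iterate_shift_iterate, hUcat, shift_cat, ← shift_iterate_shift_iterate,
          shift_iterate_reflect, shift_iterate_eq_of_mul hb, shift_iterate_reflect]
      rw [show n + n * (T + 1) - (n + n * (T + 1) - r) = r by omega] at hor ⊢
      rw [hsh] at hor
      have hag : Agree r (shift^[n - r] (lowerPeriodic a n)) (reflect a) := by
        rcases hor with h1 | h1
        · have := h1.reflect
          rwa [reflect_reflect] at this
        · have := h1.reflect
          rw [reflect_reflect, reflect_reflect] at this
          exact absurd this (hn.not_agree_lowerPeriodic ha hr0 hrn)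
      -- Length 1 lies outside the overlap criterion and need not be a cut.
      rcases (show r = 1 ∨ 2 ≤ r by omega) with rfl | hr2
      · rcases h0.eq_or_lt with heq | hlt
        · exact reaches_one heq.symm (apply_one_eq_of_not_isGolden ha hg heq.symm)
        · exact ih 1 hrn (isCut_one_iff.2 hlt)
      · exact ih r hrn (hn.of_agree_lowerPeriodic ha h0 hr2 hrn hag)
    · exfalso
      rcases Nat.eq_zero_or_pos l with rfl | hl0
      · rcases hor with h1 | h1
        · exact (hT.mono (by omega)).not_agree h1
        · exact (hlow.mono (by omega)).not_agree h1.symm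
      · have h2 := hn.ltBefore_shift_upperTail ha hl0
        rcases hor with h1 | h1
        · exact (h2.2.mono (by omega)).not_agree h1
        · exact (h2.1.mono (by omega)).not_agree h1.symm

/-! ### Transitivity for the golden sequence -/

theorem IsGolden.shift_eq_reflect {a x : Seq M} (h : IsGolden a) (hx : x ∈ shiftSet a) :
    shift^[1] x = reflect x := by
  funext i
  rw [shift_iterate_apply]
  apply Fin.ext
  rw [reflect_apply_val]
  have h1 := apply_le_of_mem hx (1 + i)
  have h2 := le_apply_of_mem hx (1 + i)
  have h3 := apply_le_of_mem hx i
  have h4 := le_apply_of_mem hx i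
  have h5 := h.2
  have ha1 : (a 1).val = M - (a 0).val := by
    have := congrArg Fin.val (congrFun h.1 0)
    rwa [shift_iterate_apply, reflect_apply_val] at this
  by_contra hne
  have heq : (x (1 + i)).val = (x i).val := by omega
  rcases (show (x i).val = (a 0).val ∨ (x i).val + 1 = (a 0).val by omega) with h6 | h6
  · refine LTBefore.not_ge (n := 2) ⟨1, by omega, fun l hl => ?_, ?_⟩ (hx i).2
    · obtain rfl : l = 0 := by omega
      rw [shift_iterate_apply]
      exact Fin.ext h6.symm
    · rw [shift_iterate_apply, Fin.lt_def, add_comm i]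
      omega
  · refine LTBefore.not_ge (n := 2) ⟨1, by omega, fun l hl => ?_, ?_⟩ (hx i).1
    · obtain rfl : l = 0 := by omega
      rw [shift_iterate_apply]
      apply Fin.ext
      rw [reflect_apply_val, add_zero]
      omega
    · rw [shift_iterate_apply, Fin.lt_def, reflect_apply_val, add_comm i]
      omega

theorem eq_of_shift_eq_reflect {x y : Seq M} (hx : shift^[1] x = reflect x)
    (hy : shift^[1] y = reflect y) (h : x 0 = y 0) : x = y := by
  funext i
  induction i with
  | zero => exact h
  | succ i ih =>
    have h1 := congrFun hx i
    have h2 := congrFun hy i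
    rw [shift_iterate_apply, add_comm 1 i] at h1 h2
    rw [h1, h2, reflect, reflect, ih]

theorem IsGolden.shift_two {a x : Seq M} (h : IsGolden a) (hx : x ∈ shiftSet a) :
    shift^[2] x = x := by
  rw [show (2 : ℕ) = 1 + 1 from rfl, ← shift_iterate_shift_iterate, h.shift_eq_reflect hx,
    shift_iterate_reflect, h.shift_eq_reflect hx, reflect_reflect]

theorem IsGolden.reaches {a x : Seq M} (h : IsGolden a) (hx : x ∈ shiftSet a) (k : ℕ) :
    Reaches a x k := by
  intro y hy
  have hx1 := h.shift_eq_reflect hx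
  have hy1 := h.shift_eq_reflect hy
  have hper : shift^[2 * k] x = x := shift_iterate_eq_of_mul (h.shift_two hx) k
  by_cases hxy : x 0 = y 0
  · exact ⟨x, hx, 2 * k, by omega, fun _ _ => rfl, by
      rw [hper, eq_of_shift_eq_reflect hx1 hy1 hxy]⟩
  · refine ⟨x, hx, 2 * k + 1, by omega, fun _ _ => rfl, ?_⟩
    rw [← shift_iterate_shift_iterate, hper, hx1]
    refine eq_of_shift_eq_reflect (by rw [shift_iterate_reflect, hx1]) hy1 (Fin.ext ?_)
    rw [reflect_apply_val]
    have h1 := apply_le_of_mem hx 0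
    have h2 := le_apply_of_mem hx 0
    have h3 := apply_le_of_mem hy 0
    have h4 := le_apply_of_mem hy 0
    have h5 := h.2
    have hne : (x 0).val ≠ (y 0).val := fun h => hxy (Fin.ext h)
    omega

theorem IsIrreducibleSeq.isTransitive {a : Seq M} (hirr : IsIrreducibleSeq a) :
    IsTransitive (shiftSet a) := by
  refine isTransitive_of_reaches fun x hx k => ?_
  by_cases hg : IsGolden a
  · exact hg.reaches hx k
  · refine Reaches.of_forall hx fun l _ _ => ?_
    obtain ⟨n, hn, hcut⟩ := exists_isCut_gt hirr hg (k - l)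
    exact (reaches_of_isCut hirr hg n hcut).mono hn.le

/-! ### Topology -/

theorem continuous_shift_iterate (n : ℕ) : Continuous (shift^[n] : Seq M → Seq M) := by
  refine Continuous.iterate ?_ n
  exact continuous_pi fun i => continuous_apply (i + 1)

theorem isOpen_lexLT (a : Seq M) : IsOpen {x : Seq M | LexLT a x} := by
  have h : {x : Seq M | LexLT a x} =
      ⋃ t, (⋂ i ∈ Set.Iio t, (fun x : Seq M => x i) ⁻¹' {a i}) ∩
        (fun x : Seq M => x t) ⁻¹' Set.Ioi (a t) := by
    ext x
    simp [LexLT, eq_comm]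
  rw [h]
  refine isOpen_iUnion fun t => IsOpen.inter ?_ ?_
  · exact (Set.finite_Iio t).isOpen_biInter fun i _ =>
      (isOpen_discrete _).preimage (continuous_apply i)
  · exact (isOpen_discrete _).preimage (continuous_apply t)

theorem isClosed_lexLE (a : Seq M) : IsClosed {x : Seq M | LexLE x a} := by
  have h : {x : Seq M | LexLE x a} = {x : Seq M | LexLT a x}ᶜ := by
    ext x
    exact not_lexLT.symm
  rw [h]
  exact (isOpen_lexLT a).isClosed_compl

theorem continuous_reflect : Continuous (reflect : Seq M → Seq M) :=
  continuous_pi fun i => (continuous_of_discreteTopology (f := Fin.rev)).comp (continuous_apply i)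

theorem isClosed_shiftSet (a : Seq M) : IsClosed (shiftSet a) := by
  have h : shiftSet a = ⋂ n : ℕ,
      ((shift^[n] : Seq M → Seq M) ⁻¹' (reflect ⁻¹' {x | LexLE x a})) ∩
        ((shift^[n] : Seq M → Seq M) ⁻¹' {x | LexLE x a}) := by
    ext x
    simp only [shiftSet, Set.mem_ofPred_eq, Set.mem_iInter, Set.mem_inter_iff, Set.mem_preimage]
    refine forall_congr' fun n => and_congr_left fun _ => ⟨fun h => ?_, fun h => ?_⟩
    · simpa [reflect_reflect] using h.reflect
    · simpa [reflect_reflect] using h.reflect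
  rw [h]
  refine isClosed_iInter fun n => IsClosed.inter ?_ ?_
  · exact ((isClosed_lexLE a).preimage continuous_reflect).preimage (continuous_shift_iterate n)
  · exact (isClosed_lexLE a).preimage (continuous_shift_iterate n)

theorem isSubshift_shiftSet {a : Seq M} (ha : a ∈ seqV M) : IsSubshift (shiftSet a) :=
  ⟨⟨a, ha⟩, isClosed_shiftSet a, fun _ hx => shift_iterate_mem hx 1⟩

theorem mem_closure_of_forall_agree {S : Set (Seq M)} {x : Seq M}
    (h : ∀ k, ∃ y ∈ S, Agree k y x) : x ∈ closure S := by
  rw [mem_closure_iff]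
  intro o ho hx
  obtain ⟨I, u, hu, hIu⟩ := isOpen_pi_iff.1 ho x hx
  obtain ⟨y, hy, hag⟩ := h (I.sup id + 1)
  refine ⟨y, hIu fun i hi => ?_, hy⟩
  rw [hag i (Nat.lt_succ_of_le (Finset.le_sup (f := id) hi))]
  exact (hu i hi).2

/-- Keep x up to its earliest suffix (within k digits) that is a prefix of a or its reflection, then
continue with b or its reflection. Bounds before that point are visibly strict. -/
theorem exists_agree_mem {a b x : Seq M} (hx : x ∈ shiftSet a) (hb : b ∈ seqV M) {k : ℕ}
    (hab : Agree k b a) : ∃ y ∈ shiftSet b, Agree k y x := by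
  classical
  have key : ∀ l ≤ k, ∀ z ∈ shiftSet b, Agree (k - l) z (shift^[l] x) →
      (∀ m < l, ¬ Agree (k - m) (shift^[m] x) a ∧ ¬ Agree (k - m) (shift^[m] x) (reflect a)) →
      ∃ y ∈ shiftSet b, Agree k y x := by
    intro l hl z hz hzx hmin
    have hag : Agree k (cat x l z) x := by
      intro i hi
      rcases lt_or_ge i l with h3 | h3
      · exact agree_cat x l z i h3
      · obtain ⟨j, rfl⟩ := Nat.exists_eq_add_of_le h3
        rw [cat_apply_add, hzx j (by omega), shift_iterate_apply]
    refine ⟨cat x l z, cat_mem hz fun m hm => ?_, hag⟩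
    have h3 := (hag.shift (l := m)).symm
    have h4 : Agree (k - m) a b := hab.symm.mono (by omega)
    constructor
    · refine ((((hx m).1.agree_or_ltBefore (k - m)).resolve_left ?_).congr h4.reflect h3).le
      exact fun hx => (hmin m hm).2 hx.symm
    · exact ((((hx m).2.agree_or_ltBefore (k - m)).resolve_left (hmin m hm).1).congr h3 h4).le
  by_cases hex : ∃ l, l < k ∧
    (Agree (k - l) (shift^[l] x) a ∨ Agree (k - l) (shift^[l] x) (reflect a))
  · obtain ⟨h1, h2⟩ := Nat.find_spec hex
    have hmin : ∀ m < Nat.find hex, ¬ Agree (k - m) (shift^[m] x) a ∧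
        ¬ Agree (k - m) (shift^[m] x) (reflect a) := by
      intro m hm
      have := Nat.find_min hex hm
      push Not at this
      exact this (by omega)
    have hab' : Agree (k - Nat.find hex) b a := hab.mono (by omega)
    rcases h2 with h3 | h3
    · exact key _ h1.le b hb (hab'.trans h3.symm) hmin
    · exact key _ h1.le _ (reflect_mem hb) (hab'.reflect.trans h3.symm) hmin
  · push Not at hex
    exact key k le_rfl b hb (fun i hi => by omega) hex

theorem shiftSet_eq_closure {a : Seq M} {b : ℕ → Seq M}
    (hb : ∀ j, b j ∈ seqV M) (hle : ∀ j, LexLE (b j) a) (hag : ∀ k, ∃ j, Agree k (b j) a) :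
    shiftSet a = closure (⋃ j, shiftSet (b j)) := by
  refine Set.Subset.antisymm (fun x hx => mem_closure_of_forall_agree fun k => ?_) ?_
  · obtain ⟨j, hj⟩ := hag k
    obtain ⟨y, hy, hyx⟩ := exists_agree_mem hx (hb j) hj
    exact ⟨y, Set.mem_iUnion.2 ⟨j, hy⟩, hyx⟩
  · exact closure_minimal (Set.iUnion_subset fun j => shiftSet_mono (hle j))
      (isClosed_shiftSet a)

/-! ### Subshifts of finite type -/

/-- A violation first visible at t ≥ p is, by periodicity of b, a violation of a later shift visible
at t - p. -/
theorem shift_le_of_forall_not_ltBefore {x b : Seq M} {p : ℕ} (hp : 0 < p)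
    (hper : shift^[p] b = b) (h : ∀ k, ¬ LTBefore p b (shift^[k] x)) (k : ℕ) :
    LexLE (shift^[k] x) b := by
  rw [← not_lexLT]
  rintro ⟨t, ht⟩
  induction t using Nat.strong_induction_on generalizing k with
  | _ t ih =>
    rcases lt_or_ge t p with h1 | h1
    · exact h k ⟨t, h1, ht⟩
    · have hb : ∀ i, b (p + i) = b i := fun i => by rw [← shift_iterate_apply p b i, hper]
      obtain ⟨s, rfl⟩ := Nat.exists_eq_add_of_le h1
      refine ih s (by omega) (k + p) ⟨fun i hi => ?_, ?_⟩
      · have := ht.1 (p + i) (by omega)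
        rwa [hb, ← shift_iterate_apply p (shift^[k] x) i, shift_iterate_shift_iterate] at this
      · have := ht.2
        rwa [hb, ← shift_iterate_apply p (shift^[k] x) s, shift_iterate_shift_iterate] at this

theorem isSFT_shiftSet {b : Seq M} (hb : b ∈ seqV M) {p : ℕ} (hp : 0 < p)
    (hper : shift^[p] b = b) : IsSFT (shiftSet b) := by
  refine ⟨isSubshift_shiftSet hb,
    {w | ∃ y : Seq M, (LTBefore p b y ∨ LTBefore p y (reflect b)) ∧
      w = List.ofFn fun i : Fin p => y i}, ?_, ?_⟩
  · refine (List.finite_length_eq (Fin (M + 1)) p).subset ?_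
    rintro w ⟨y, -, rfl⟩
    simp
  · ext x
    constructor
    · rintro hx w ⟨y, hy, rfl⟩ ⟨k, hk⟩
      have hag : Agree p y (shift^[k] x) := by
        intro i hi
        have := hk i (by simpa using hi)
        rw [shift_iterate_apply, ← this]
        simp
      rcases hy with h | h
      · exact (h.congr (fun _ _ => rfl) hag).not_ge (hx k).2
      · exact (h.congr hag (fun _ _ => rfl)).not_ge (hx k).1
    · intro hx
      have hfac : ∀ k, IsFactor (List.ofFn fun i : Fin p => (shift^[k] x) i) x := by
        intro k
        refine ⟨k, fun i hi => ?_⟩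
        simp [shift_iterate_apply]
      intro k
      constructor
      · have := shift_le_of_forall_not_ltBefore (x := reflect x) hp hper (fun m h => ?_) k
        · rw [shift_iterate_reflect] at this
          simpa [reflect_reflect] using this.reflect
        · rw [shift_iterate_reflect] at h
          have h' := h.reflect
          rw [reflect_reflect] at h'
          exact hx _ ⟨_, Or.inr h', rfl⟩ (hfac m)
      · exact shift_le_of_forall_not_ltBefore hp hper
          (fun m h => hx _ ⟨_, Or.inl h, rfl⟩ (hfac m)) k

/-! ### Quasi-greedy expansions -/

/-- The value `∑_{i ≥ 1} x_i / q ^ i`. -/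
noncomputable def expVal (q : ℝ) (x : Seq M) : ℝ := ∑' i : ℕ, ((x i : ℕ) : ℝ) / q ^ (i + 1)

theorem hasSum_geometric_tail {q : ℝ} (hq : 1 < q) :
    HasSum (fun i : ℕ => (M : ℝ) / q ^ (i + 1)) (M / (q - 1)) := by
  have h1 := (hasSum_geometric_of_lt_one (inv_nonneg.2 (by linarith : (0 : ℝ) ≤ q))
    (inv_lt_one_of_one_lt₀ hq)).mul_left ((M : ℝ) / q)
  have h2 : (M : ℝ) / q * (1 - q⁻¹)⁻¹ = M / (q - 1) := by
    have : q - 1 ≠ 0 := by linarith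
    have : q ≠ 0 := by linarith
    have : 1 - q⁻¹ ≠ 0 := by
      rw [sub_ne_zero]
      exact (inv_lt_one_of_one_lt₀ hq).ne'
    field_simp
  rw [h2] at h1
  refine h1.congr_fun ?_
  intro i
  rw [inv_pow, pow_succ]
  field_simp

theorem digit_le (x : Seq M) (i : ℕ) : ((x i : ℕ) : ℝ) ≤ M := by
  exact_mod_cast Nat.lt_succ_iff.1 (x i).isLt

theorem summable_expVal {q : ℝ} (hq : 1 < q) (x : Seq M) :
    Summable fun i : ℕ => ((x i : ℕ) : ℝ) / q ^ (i + 1) := by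
  refine Summable.of_nonneg_of_le (fun i => by positivity) (fun i => ?_)
    (hasSum_geometric_tail (M := M) hq).summable
  have := digit_le x i
  gcongr

theorem expVal_le {q : ℝ} (hq : 1 < q) (x : Seq M) : expVal q x ≤ M / (q - 1) := by
  refine hasSum_le (fun i => ?_) (summable_expVal hq x).hasSum (hasSum_geometric_tail hq)
  have := digit_le x i
  gcongr

theorem expVal_eq {q : ℝ} (hq : 1 < q) (x : Seq M) (n : ℕ) :
    expVal q x = ∑ i ∈ Finset.range n, ((x i : ℕ) : ℝ) / q ^ (i + 1) +
      expVal q (shift^[n] x) / q ^ n := by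
  rw [expVal, ← (summable_expVal hq x).sum_add_tsum_nat_add n, expVal, ← tsum_div_const]
  congr 2
  funext i
  rw [shift_iterate_apply, div_div, ← pow_add, add_comm i n]
  congr 2
  omega

theorem expVal_eq_succ {q : ℝ} (hq : 1 < q) (x : Seq M) (n : ℕ) :
    expVal q x = ∑ i ∈ Finset.range n, ((x i : ℕ) : ℝ) / q ^ (i + 1) +
      ((x n : ℕ) + expVal q (shift^[n + 1] x)) / q ^ (n + 1) := by
  rw [expVal_eq hq x (n + 1), Finset.sum_range_succ]
  ring

theorem expVal_sub {q : ℝ} (hq : 1 < q) {x y : Seq M} {t : ℕ} (h : ∀ i < t, x i = y i) :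
    expVal q y - expVal q x = (((y t : ℕ) : ℝ) - (x t : ℕ) + expVal q (shift^[t + 1] y) -
      expVal q (shift^[t + 1] x)) / q ^ (t + 1) := by
  have hsum : ∑ i ∈ Finset.range t, ((x i : ℕ) : ℝ) / q ^ (i + 1) =
      ∑ i ∈ Finset.range t, ((y i : ℕ) : ℝ) / q ^ (i + 1) :=
    Finset.sum_congr rfl fun i hi => by rw [h i (Finset.mem_range.1 hi)]
  rw [expVal_eq_succ hq x t, expVal_eq_succ hq y t, hsum]
  ring

theorem expVal_nonneg {q : ℝ} (hq : 1 < q) (x : Seq M) : 0 ≤ expVal q x :=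
  tsum_nonneg fun i => by positivity

theorem expVal_pos {q : ℝ} (hq : 1 < q) {x : Seq M} {i : ℕ} (h : x i ≠ 0) : 0 < expVal q x := by
  refine (summable_expVal hq x).tsum_pos (fun i => by positivity) i ?_
  have h1 : (x i).val ≠ 0 := fun h1 => h (Fin.ext h1)
  have : (0 : ℝ) < (x i).val := by exact_mod_cast Nat.pos_of_ne_zero h1
  positivity

/-- A uniform bound on the excess over 1 improves itself: at the first difference from b a shift
loses a whole digit, so its excess is at most that of a later shift divided by a positive power of
q. -/
theorem expVal_shift_le_one {q : ℝ} (hq : 1 < q) {b : Seq M} (hb : expVal q b = 1)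
    (hmax : ∀ n, LexLE (shift^[n] b) b) (k : ℕ) : expVal q (shift^[k] b) ≤ 1 := by
  set C : ℝ := M / (q - 1) with hC
  have hC0 : 0 ≤ C := div_nonneg (Nat.cast_nonneg _) (by linarith)
  have key : ∀ n k, expVal q (shift^[k] b) - 1 ≤ C / q ^ n := by
    intro n
    induction n with
    | zero =>
      intro k
      have := expVal_le hq (shift^[k] b)
      rw [pow_zero, div_one]
      linarith
    | succ n ih =>
      intro k
      rcases hmax k with heq | ⟨t, h1, h2⟩
      · rw [heq, hb, sub_self]
        positivity
      · have h3 := expVal_sub hq h1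
        have h4 : ((shift^[k] b t : ℕ) : ℝ) + 1 ≤ (b t : ℕ) := by exact_mod_cast h2
        have h5 := expVal_nonneg hq (shift^[t + 1] b)
        have h6 := ih (k + (t + 1))
        rw [shift_iterate_shift_iterate, hb] at h3
        have h7 : -(C / q ^ n) / q ^ (t + 1) ≤ 1 - expVal q (shift^[k] b) := by
          rw [h3]
          gcongr
          linarith
        have h8 : C / q ^ n / q ^ (t + 1) ≤ C / q ^ (n + 1) := by
          rw [div_div, ← pow_add]
          gcongr
          · exact hq.le
          · omega
        rw [neg_div] at h7
        linarith
  have hlim : Filter.Tendsto (fun n : ℕ => C / q ^ n) Filter.atTop (nhds 0) :=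
    Filter.Tendsto.div_atTop tendsto_const_nhds (tendsto_pow_atTop_atTop_of_one_lt hq)
  have := ge_of_tendsto' hlim fun n => key n k
  linarith

theorem isExpansionOne_iff {q : ℝ} (hq : 1 < q) {x : Seq M} :
    IsExpansionOne q x ↔ expVal q x = 1 :=
  (summable_expVal hq x).hasSum_iff

/-- A larger infinite expansion gains at least one unit at the first difference and has a positive
tail, while the tail of b is worth at most 1; the values could not be equal. -/
theorem isQuasiGreedy_of_shift_le {q : ℝ} (hq : 1 < q) {b : Seq M}
    (hb : IsInfiniteExpansionOne q b) (hmax : ∀ n, LexLE (shift^[n] b) b) :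
    IsQuasiGreedy q b := by
  refine ⟨hb, fun c hc => not_lexLT.1 ?_⟩
  rintro ⟨t, h1, h2⟩
  have hb1 := (isExpansionOne_iff hq).1 hb.1
  have h3 := expVal_sub hq h1
  rw [hb1, (isExpansionOne_iff hq).1 hc.1, sub_self, eq_comm, div_eq_zero_iff,
    or_iff_left (by positivity)] at h3
  have h4 : ((b t : ℕ) : ℝ) + 1 ≤ (c t : ℕ) := by exact_mod_cast h2
  have h5 := expVal_shift_le_one hq hb1 hmax (t + 1)
  obtain ⟨i, hi, hit⟩ := hc.2.exists_gt t
  have h6 : 0 < expVal q (shift^[t + 1] c) := by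
    refine expVal_pos hq (i := i - (t + 1)) ?_
    rw [shift_iterate_apply, show t + 1 + (i - (t + 1)) = i by omega]
    exact hi
  linarith

theorem quasiGreedy_eq {q : ℝ} {b : Seq M} (h : IsQuasiGreedy q b) : quasiGreedy M q = b := by
  have hex : ∃ a : Seq M, IsQuasiGreedy q a := ⟨b, h⟩
  rw [quasiGreedy, dif_pos hex]
  exact (h.2 _ hex.choose_spec.1).antisymm (hex.choose_spec.2 _ h.1)

/-- A zero tail bounds the reflection of b by 0, so all digits of b equal M, a contradiction. -/
theorem exists_ne_zero_of_mem_seqV (hM : 0 < M) {b : Seq M} (hb : b ∈ seqV M) (n : ℕ) :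
    ∃ i ≥ n, b i ≠ 0 := by
  by_contra! hc
  have h1 : ∀ i, reflect b i = 0 := by
    intro i
    by_contra hne
    have hex : ∃ i, reflect b i ≠ 0 := ⟨i, hne⟩
    classical
    refine LTBefore.not_ge (n := Nat.find hex + 1) ⟨Nat.find hex, by omega, fun j hj => ?_, ?_⟩
      (hb n).1
    · rw [shift_iterate_apply, hc _ (by omega), not_not.1 (Nat.find_min hex hj)]
    · rw [shift_iterate_apply, hc _ (by omega)]
      exact Fin.pos_iff_ne_zero.2 (Nat.find_spec hex)
  have h2 := congrArg Fin.val (h1 n)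
  rw [reflect_apply_val, hc n le_rfl] at h2
  simp at h2
  omega

/-- Intermediate value theorem: two non-zero digits push the value above 1 as q tends to 1, and at q
= M + 1 it is at most 1. -/
theorem exists_expVal_eq_one (hM : 0 < M) {b : Seq M} (hb : b ∈ seqV M) :
    ∃ q : ℝ, 1 < q ∧ q ≤ (M : ℝ) + 1 ∧ expVal q b = 1 := by
  have hM' : (0 : ℝ) < M := by exact_mod_cast hM
  have hb0 : b 0 ≠ 0 := by
    intro h
    have h1 := apply_le_of_mem hb 0
    have h2 := le_apply_of_mem hb 0
    rw [h] at h2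
    simp at h2
    omega
  obtain ⟨j, hj, hbj⟩ := exists_ne_zero_of_mem_seqV hM hb 1
  have hone : ∀ i, b i ≠ 0 → (1 : ℝ) ≤ (b i : ℕ) := by
    intro i hi
    have : (b i).val ≠ 0 := fun h => hi (Fin.ext h)
    exact_mod_cast Nat.one_le_iff_ne_zero.2 this
  have hlim : Filter.Tendsto (fun q : ℝ => 1 / q ^ 1 + 1 / q ^ (j + 1)) (nhdsWithin 1 (Set.Ioi 1))
      (nhds (1 / 1 ^ 1 + 1 / 1 ^ (j + 1))) := by
    refine (ContinuousAt.tendsto ?_).mono_left nhdsWithin_le_nhds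
    exact (continuousAt_const.div (continuousAt_id.pow _) (by simp)).add
      (continuousAt_const.div (continuousAt_id.pow _) (by simp))
  have hev := hlim.eventually (lt_mem_nhds (show (1 : ℝ) < 1 / 1 ^ 1 + 1 / 1 ^ (j + 1) by norm_num))
  obtain ⟨r, hr1, hr2, hr3⟩ := (hev.and (Ioo_mem_nhdsGT (show (1 : ℝ) < M + 1 by linarith))).exists
  have hr : 1 ≤ expVal r b := by
    have h1 := (summable_expVal hr2 b).sum_le_tsum {0, j} (fun i _ => by positivity)
    rw [Finset.sum_pair (by omega)] at h1
    refine le_trans hr1.le (le_trans ?_ h1)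
    have := hone 0 hb0
    have := hone j hbj
    rw [zero_add]
    gcongr
  have hcont : ContinuousOn (fun q : ℝ => expVal q b) (Set.Icc r (M + 1)) := by
    refine continuousOn_tsum (u := fun i => (M : ℝ) / r ^ (i + 1)) (fun i => ?_)
      (hasSum_geometric_tail hr2).summable fun i q hq => ?_
    · refine continuousOn_const.div (continuousOn_id.pow _) fun q hq => ?_
      have : 0 < q := by linarith [hq.1]
      positivity
    · have h0 : 0 < q := by linarith [hq.1]
      rw [Real.norm_of_nonneg (by positivity)]
      have := digit_le b i
      have := hq.1
      gcongr
  have hend : expVal ((M : ℝ) + 1) b ≤ 1 := by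
    have := expVal_le (show (1 : ℝ) < M + 1 by linarith) b
    rwa [add_sub_cancel_right, div_self hM'.ne'] at this
  obtain ⟨q, hq, hq1⟩ := intermediate_value_Icc' hr3.le hcont ⟨hend, hr⟩
  exact ⟨q, by linarith [hq.1], hq.2, hq1⟩

theorem exists_quasiGreedy_eq (hM : 0 < M) {b : Seq M} (hb : b ∈ seqV M) :
    ∃ q ∈ baseV M, quasiGreedy M q = b := by
  obtain ⟨q, hq1, hq2, hq3⟩ := exists_expVal_eq_one hM hb
  have hinf : IsInfiniteExpansionOne q b := by
    refine ⟨(isExpansionOne_iff hq1).2 hq3, ?_⟩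
    refine Set.infinite_of_not_bddAbove ?_
    rintro ⟨n, hn⟩
    obtain ⟨i, hi, hi'⟩ := exists_ne_zero_of_mem_seqV hM hb (n + 1)
    have := hn hi'
    omega
  have heq := quasiGreedy_eq (isQuasiGreedy_of_shift_le hq1 hinf fun n => (hb n).2)
  exact ⟨q, ⟨hq1, hq2, by rwa [heq]⟩, heq⟩

/-! ### The natural approximation -/

theorem naturalApprox_of_isCut (hM : 0 < M) {q : ℝ} {m : ℕ}
    (h : IsCut (quasiGreedy M q) (Nat.nth (IsCut (quasiGreedy M q)) m)) :
    naturalApprox M q m ∈ baseV M ∧ quasiGreedy M (naturalApprox M q m) =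
      lowerPeriodic (quasiGreedy M q) (Nat.nth (IsCut (quasiGreedy M q)) m) := by
  have hex : ∃ q' ∈ baseV M, quasiGreedy M q' =
      lowerPeriodic (quasiGreedy M q) (Nat.nth (IsCut (quasiGreedy M q)) m) :=
    exists_quasiGreedy_eq hM h.2.2
  simp only [naturalApprox]
  rw [if_pos h]
  exact ⟨Function.invFunOn_mem hex, Function.invFunOn_eq hex⟩

theorem naturalApprox_of_isGolden {q : ℝ} (h : IsGolden (quasiGreedy M q)) (m : ℕ) :
    naturalApprox M q m = q := by
  simp only [naturalApprox]
  rw [if_neg (h.not_isCut _)]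

theorem pos_of_mem_baseV {q : ℝ} (h : q ∈ baseV M) : 0 < M := by
  have h1 := h.1.trans_le h.2.1
  have h2 : (0 : ℝ) < M := by linarith
  exact_mod_cast h2

theorem infinite_setOf_naturalApprox_mem {q : ℝ} (hq : q ∈ irreducibleBases M) :
    {m : ℕ | naturalApprox M q m ∈ irreducibleBases M}.Infinite := by
  by_cases hg : IsGolden (quasiGreedy M q)
  · simp only [naturalApprox_of_isGolden hg, hq]
    exact Set.infinite_univ
  · classical
    have hM := pos_of_mem_baseV hq.1
    have hcuts : {n | IsCut (quasiGreedy M q) n ∧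
        IsIrreducibleSeq (lowerPeriodic (quasiGreedy M q) n)}.Infinite := by
      refine Set.infinite_of_not_bddAbove ?_
      rintro ⟨K, hK⟩
      obtain ⟨n, hn, h1⟩ := exists_isIrreducibleSeq_lowerPeriodic hq.2 hg K
      have := hK h1
      omega
    refine Set.Infinite.of_image (Nat.nth (IsCut (quasiGreedy M q))) (hcuts.mono ?_)
    rintro n ⟨h1, h2⟩
    have hn := Nat.nth_count h1
    refine ⟨Nat.count (IsCut (quasiGreedy M q)) n, ?_, hn⟩
    have h3 := naturalApprox_of_isCut hM (m := Nat.count (IsCut (quasiGreedy M q)) n)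
      (by rwa [hn])
    rw [hn] at h3
    refine ⟨h3.1, ?_⟩
    rwa [h3.2]

theorem symShift_naturalApprox {q : ℝ} (hq : q ∈ irreducibleBases M) {φ : ℕ → ℕ}
    (hφ : StrictMono φ) (h : ∀ j, naturalApprox M q (φ j) ∈ irreducibleBases M) :
    (∀ j, IsSFT (symShift M (naturalApprox M q (φ j))) ∧
      IsTransitive (symShift M (naturalApprox M q (φ j)))) ∧
    (∀ j, symShift M (naturalApprox M q (φ j)) ⊆ symShift M (naturalApprox M q (φ (j + 1)))) ∧
    symShift M q = closure (⋃ j, symShift M (naturalApprox M q (φ j))) := by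
  simp only [symShift_eq_shiftSet]
  by_cases hg : IsGolden (quasiGreedy M q)
  · simp only [naturalApprox_of_isGolden hg]
    refine ⟨fun _ => ⟨isSFT_shiftSet hq.1.2.2 two_pos (hg.shift_two hq.1.2.2),
      hq.2.isTransitive⟩, fun _ => subset_rfl, ?_⟩
    rw [Set.iUnion_const, (isClosed_shiftSet _).closure_eq]
  · have hM := pos_of_mem_baseV hq.1
    have hinf : {n | IsCut (quasiGreedy M q) n}.Infinite := by
      refine Set.infinite_of_not_bddAbove ?_
      rintro ⟨K, hK⟩
      obtain ⟨n, hn, h1⟩ := exists_isCut_gt hq.2 hg K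
      have := hK h1
      omega
    have hirr := fun j => (h j).2
    have hcut : ∀ m, IsCut (quasiGreedy M q) (Nat.nth (IsCut (quasiGreedy M q)) m) :=
      Nat.nth_mem_of_infinite hinf
    have hmono : StrictMono fun j => Nat.nth (IsCut (quasiGreedy M q)) (φ j) :=
      (Nat.nth_strictMono hinf).comp hφ
    simp only [(naturalApprox_of_isCut hM (hcut _)).2] at hirr ⊢
    generalize quasiGreedy M q = a at *
    have hlt := fun j => ltBefore_lowerPeriodic (hcut (φ j)).1 (hcut (φ j)).2.1
    refine ⟨fun j => ⟨isSFT_shiftSet (hcut _).2.2 (hcut _).1 (shift_lowerPeriodic _ _),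
      (hirr j).isTransitive⟩, fun j => shiftSet_mono ?_,
      shiftSet_eq_closure (fun j => (hcut _).2.2) (fun j => (hlt j).le) fun k => ⟨k + 1, ?_⟩⟩
    · have := hmono (Nat.lt_succ_self j)
      exact ((hlt j).congr (fun _ _ => rfl)
        ((agree_lowerPeriodic a _).mono (Nat.le_sub_one_of_lt this)).symm).le
    -- The cut used has length at least k + 1; the extra unit pays for the lowered last digit.
    · have := hmono.le_apply (x := k + 1)
      exact (agree_lowerPeriodic a _).mono (Nat.le_sub_one_of_lt this)

end SymShift

theorem mainTheorem2 (M : ℕ) (q : ℝ) (hq : q ∈ SymShift.irreducibleBases M) :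
    SymShift.IsCoded (SymShift.symShift M q) ∧
    {m : ℕ | SymShift.naturalApprox M q m ∈ SymShift.irreducibleBases M}.Infinite ∧
    ∀ φ : ℕ → ℕ, StrictMono φ →
      (∀ j, SymShift.naturalApprox M q (φ j) ∈ SymShift.irreducibleBases M) →
      (∀ j, SymShift.IsSFT (SymShift.symShift M (SymShift.naturalApprox M q (φ j))) ∧
        SymShift.IsTransitive (SymShift.symShift M (SymShift.naturalApprox M q (φ j)))) ∧
      (∀ j, SymShift.symShift M (SymShift.naturalApprox M q (φ j)) ⊆
        SymShift.symShift M (SymShift.naturalApprox M q (φ (j + 1)))) ∧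
      SymShift.symShift M q =
        closure (⋃ j, SymShift.symShift M (SymShift.naturalApprox M q (φ j))) := by
  have hinf := SymShift.infinite_setOf_naturalApprox_mem hq
  refine ⟨⟨SymShift.isSubshift_shiftSet hq.1.2.2, _,
    SymShift.symShift_naturalApprox hq (Nat.nth_strictMono hinf)
      fun j => Nat.nth_mem_of_infinite hinf j⟩, hinf,
    fun φ hφ h => SymShift.symShift_naturalApprox hq hφ h⟩
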